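/- For multisets $S,T$ of points of $[\Delta]^2=\{1,\dots,\Delta\}^2$ with $|S|=|T|$, let $EMD(S,T)=\min_{\pi}\sum_{a\in S}\|a-\pi(a)\|_1$, where $\pi$ ranges over all bijections $S\to T$ (points counted with multiplicity). In the insertion-only model, the points of $S$ and $T$ arrive one at a time, in an arbitrary (interleaved) order, each labelled with the multiset it belongs to. A one-pass streaming algorithm is given by three computable procedures: one sets up the initial memory, one computes the new memory from the old memory and the arriving labelled point, and one computes the reported estimate from the final memory. All three may read the parameters $k$, $\Delta$ and a precision; the number of points is not given in advance. Memory is a list of words (natural numbers), and the space used on a stream is the largest number of words stored at any moment between arrivals (including before the first and after the last one); scratch space inside the three procedures and the read-only parameters are not counted. Theorem. There are a deterministic one-pass streaming algorithm and absolute constants $C,c$ such that the following holds for every real $\varepsilon>0$, all $k,\Delta$, every $n\ge 2$, and all multisets $S,T\subseteq[\Delta]^2$ with $|S|=|T|=n$ such that $S$ or $T$ has at most $k$ distinct points. The algorithm receives the parameters $k$, $\Delta$ and any fraction $p/q$ of positive integers with $p/q\le\varepsilon\le 2p/q$ (for instance $p/q=\varepsilon$ if $\varepsilon$ is rational). On every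 insertion-only stream that reveals $S$ and $T$, it reports at the end of the stream a number $Z$ with $$(1-\varepsilon)\,EMD(S,T)\le Z\le(1+\varepsilon)\,EMD(S,T),$$ and it uses space at most $C\,k\,\varepsilon^{-2}\log^4 n$ words, each of which is at most $(n\Delta)^c$, that is, has $O(\log(n\Delta))$ bits. -/

import Mathlib

namespace EMDStream

/-- A point of the integer grid. -/
abbrev Point : Type := ℕ × ℕ

/-- The point `p` lies in `[Δ]² = {1, …, Δ}²`. -/
def InGrid (Δ : ℕ) (p : Point) : Prop :=
  (1 ≤ p.1 ∧ p.1 ≤ Δ) ∧ (1 ≤ p.2 ∧ p.2 ≤ Δ)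

/-- The `ℓ₁` distance `‖p - q‖₁`. -/
noncomputable def l1Dist (p q : Point) : ℝ :=
  |(p.1 : ℝ) - (q.1 : ℝ)| + |(p.2 : ℝ) - (q.2 : ℝ)|

/-- Earth-mover distance of two multisets of equal cardinality: the minimum, over all bijections
`π` between the elements (counted with multiplicity) of `S` and those of `T`, of
`∑ a ∈ S, ‖a - π a‖₁`. The infimum is over a finite set of bijections, which is nonempty exactly
when the cardinalities agree; only that case is ever used. -/
noncomputable def emd (S T : Multiset Point) : ℝ :=
  ⨅ π : S.ToType ≃ T.ToType, ∑ a : S.ToType, l1Dist a.1 (π a).1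

/-- An item of an insertion-only stream: a labelled point. The label `true` means "insert the
point into `S`", the label `false` means "insert the point into `T`". -/
abbrev Item : Type := Bool × Point

/-- The multiset of the points of the stream `l` that carry the label `b`. -/
def inserted (b : Bool) (l : List Item) : Multiset Point :=
  (((l.filter fun x => x.1 == b).map fun x => x.2 : List Point) : Multiset Point)

/-- The insertion-only stream `l` reveals the multisets `S` and `T`, in whatever order and with
whatever interleaving. -/
def Reveals (l : List Item) (S T : Multiset Point) : Prop :=
  inserted true l = S ∧ inserted false l = T

/-- The parameters that are given to the algorithm in advance: the bound `k` on the number of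
distinct points, the side length `Δ` of the grid, and the precision, as a fraction `p / q`.
The number `n` of points is not among them. -/
structure Params where
  k : ℕ
  Δ : ℕ
  p : ℕ
  q : ℕ

/-- The parameters as a tuple, which is how computability of the algorithm refers to them. -/
abbrev ParamTuple : Type := ℕ × ℕ × ℕ × ℕ

/-- The tuple of a list of parameters. -/
def Params.tuple (P : Params) : ParamTuple := (P.k, P.Δ, P.p, P.q)

/-- A deterministic one-pass streaming algorithm. Its memory is a list of words (natural numbers;
their size is bounded where the space is measured). It starts from the memory `init`, replaces
its memory by `update` whenever an item arrives, seeing only the item and the present memory, and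
at the end computes its estimate from the final memory by `output`. The three procedures are
computable, uniformly in the parameters. -/
structure StreamingAlgorithm where
  init : ParamTuple → List ℕ
  update : ParamTuple → List ℕ → Item → List ℕ
  output : ParamTuple → List ℕ → ℕ
  computable_init : Computable init
  computable_update :
    Computable fun x : ParamTuple × List ℕ × Item => update x.1 x.2.1 x.2.2
  computable_output : Computable fun x : ParamTuple × List ℕ => output x.1 x.2

namespace StreamingAlgorithm

/-- The memory after the algorithm has read the items of `l`, once and in order. -/
def memory (A : StreamingAlgorithm) (P : Params) (l : List Item) : List ℕ :=
  l.foldl (A.update P.tuple) (A.init P.tuple)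

/-- The estimate reported at the end of the stream `l`. -/
def estimate (A : StreamingAlgorithm) (P : Params) (l : List Item) : ℕ :=
  A.output P.tuple (A.memory P l)

/-- On the stream `l`, the memory of the algorithm consists at every moment (after every prefix of
the stream, the empty one and `l` included) of at most `s` words, each of which is a natural number
that is at most `W`. -/
def UsesSpace (A : StreamingAlgorithm) (P : Params) (l : List Item) (s : ℝ) (W : ℕ) : Prop :=
  ∀ l' : List Item, l' <+: l →
    ((A.memory P l').length : ℝ) ≤ s ∧ ∀ w ∈ A.memory P l', w ≤ W

end StreamingAlgorithm

end EMDStream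

namespace EMDStream

/-! ### The algorithm -/

/-! Call the distinct points of the multiset that has at most `k` of them centers. This multiset is
at distance zero from the centers, and an optimal matching sends every point of the other one to a
center. So the total distance of all points to their nearest centers is at most the EMD
(`centerCost_le_emd`). By the triangle inequality it suffices to keep, for each label, a multiset
with few distinct points to which the inserted points can be moved at cost at most `1 / e` times
their distance to the centers, where `e = invPrec P ≥ 1 / ε`. The final estimate is the exact EMD of
the two stored multisets.

For a fixed multiset such a summary exists: cut the surroundings of each center into dyadic rings
and each ring into square cells, and keep one point per cell (`exists_snap`). The algorithm does not
know the centers, but an exhaustive search for the cheapest representatives does at least as well,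
for all choices of at most `k` centers at once.

In the stream, points enter at level 0, and a level with more than `2 m` distinct points is snapped
to at most `m` points, which move up one level. If a distinct point of level `i` weighs `2 ^ i`,
compressions do not increase the total weight, so the number of levels is logarithmic in the number
of points (`StateInv.map_snapCell`). Each compression has relative error of order `1 / (e * number
of levels)`, and these errors add up to at most `1 / e` (`CostInv.compress`).

Since `n` is unknown, the points of each label are split into epochs, epoch `a` ending before
arrival `2 ^ 2 ^ a`. It has `2 ^ a` levels of capacity `O(k e² 8 ^ a)`, hence `O(k e² 16 ^ a)`
distinct cells. The last epoch dominates the sum, and there `16 ^ a = O(log⁴ n)`. -/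

/-- The `ℓ₁` distance of two grid points as a natural number. -/
def natDist (x y : Point) : ℕ := (x.1 - y.1 + (y.1 - x.1)) + (x.2 - y.2 + (y.2 - x.2))

/-- A minimiser of `c` over `d :: l`. -/
def argminOn {β : Type*} (c : β → ℕ) (d : β) (l : List β) : β :=
  l.foldl (fun b a => if c a < c b then a else b) d

/-- A point of `(0, 0) :: R` that is nearest to `z`. -/
def nearest (R : List Point) (z : Point) : Point := argminOn (natDist z) (0, 0) R

/-- The cost of moving every point of `Y` to the nearest representative. -/
def snapCost (Y R : List Point) : ℕ := (Y.map fun y => natDist y (nearest R y)).sum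

/-- Fewer than `m` representatives, chosen among the points of `Y`, of minimum snapping cost. -/
def bestReps (m : ℕ) (Y : List Point) : List Point :=
  argminOn (snapCost Y) [] (Y.sublists'.filter fun R => R.length < m)

/-- A stored point, together with its epoch and its level within the epoch. -/
abbrev Cell : Type := ℕ × ℕ × Point

/-- An upper bound for `q / p`, the inverse of the precision. -/
def invPrec (P : ParamTuple) : ℕ := P.2.2.2 / P.2.2.1 + 1

/-- The number of representatives per level in epoch `a`. -/
def capacity (P : ParamTuple) (a : ℕ) : ℕ := 1157 * P.1 * invPrec P ^ 2 * 8 ^ a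

/-- The epoch in which the `t`-th point arrives: the least `a` with `t < 2 ^ 2 ^ a`. -/
def epoch (t : ℕ) : ℕ := Nat.findGreatest (fun a => a = 0 ∨ 2 ^ 2 ^ (a - 1) ≤ t) t

/-- The points that are stored in level `i` of epoch `a`. -/
def pointsAt (a i : ℕ) (L : List Cell) : List Point :=
  (L.filter fun z => z.1 = a ∧ z.2.1 = i).map fun z => z.2.2

/-- Move a cell of level `i` of epoch `a` to the nearest representative, one level up. -/
def snapCell (a i : ℕ) (R : List Point) (z : Cell) : Cell :=
  if z.1 = a ∧ z.2.1 = i then (a, i + 1, nearest R z.2.2) else z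

/-- Compress level `i` of epoch `a` if it holds too many distinct points. -/
def compress (P : ParamTuple) (a : ℕ) (L : List Cell) (i : ℕ) : List Cell :=
  if 2 * capacity P a < (pointsAt a i L).dedup.length then
    L.map (snapCell a i (bestReps (capacity P a) (pointsAt a i L)))
  else L

/-- Insert a point and compress all levels of the current epoch. -/
def insertPoint (P : ParamTuple) (L : List Cell) (y : Point) : List Cell :=
  (List.range (2 ^ epoch (L.length + 1))).foldl (compress P (epoch (L.length + 1)))
    ((epoch (L.length + 1), 0, y) :: L)

/-- The memory that represents a list of labelled cells: a word for every distinct entry, which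
encodes the entry and its multiplicity. -/
def compact (L : List (ℕ × Cell)) : List ℕ :=
  L.dedup.map fun z => Encodable.encode (L.count z, z)

/-- The list of labelled cells that a memory represents. -/
def expand (M : List ℕ) : List (ℕ × Cell) :=
  M.flatMap fun w => List.replicate (Denumerable.ofNat (ℕ × ℕ × Cell) w).1
    (Denumerable.ofNat (ℕ × ℕ × Cell) w).2

/-- The cells with label `b`. -/
def labelled (b : ℕ) (L : List (ℕ × Cell)) : List Cell :=
  (L.filter fun z => z.1 = b).map fun z => z.2

/-- The memory after the arrival of `x`. -/
def nextMemory (P : ParamTuple) (M : List ℕ) (x : Item) : List ℕ :=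
  if P.2.2.2 ≤ P.2.2.1 then [] else
    compact (((expand M).filter fun z => ¬ z.1 = x.1.toNat) ++
      (insertPoint P (labelled x.1.toNat (expand M)) x.2).map fun z => (x.1.toNat, z))

/-- The cost of matching two lists entry by entry. -/
def alignCost (S T : List Point) : ℕ :=
  ((List.range S.length).map fun i => natDist (S.getI i) (T.getI i)).sum

/-- The earth-mover distance of two lists, by exhaustive search. -/
def minCost (S T : List Point) : ℕ :=
  alignCost S (argminOn (alignCost S) T T.permutations')

/-- The points with label `b` that a memory represents. -/
def storedPoints (b : ℕ) (M : List ℕ) : List Point :=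
  (labelled b (expand M)).map fun z => z.2.2

/-- The estimate computed from the final memory. -/
def finalEstimate (P : ParamTuple) (M : List ℕ) : ℕ :=
  if P.2.2.2 ≤ P.2.2.1 then 0 else minCost (storedPoints 1 M) (storedPoints 0 M)

/-! ### Computability -/

section Primrec

variable {α β σ : Type*} [Primcodable α] [Primcodable β] [Primcodable σ]

theorem primrec_filter {f : α → List β} {p : α → β → Prop} [∀ a, DecidablePred (p a)]
    (hf : Primrec f) (hp : PrimrecPred fun x : α × β => p x.1 x.2) :
    Primrec fun a => (f a).filter fun b => p a b := by
  have h : Primrec fun a => (f a).filterMap fun b => if p a b then some b else none :=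
    Primrec.listFilterMap hf
      (Primrec.ite hp (Primrec.option_some.comp Primrec.snd) (Primrec.const none))
  refine h.of_eq fun a => ?_
  induction f a with
  | nil => rfl
  | cons b l ih => by_cases hb : p a b <;> simp [hb, ih]

theorem primrec_sum {f : α → List ℕ} (hf : Primrec f) : Primrec fun a => (f a).sum :=
  (Primrec.list_foldr hf (Primrec.const 0)
    (Primrec.nat_add.comp (Primrec.fst.comp Primrec.snd) (Primrec.snd.comp Primrec.snd)).to₂).of_eq
    fun _ => rfl

theorem primrec_pow : Primrec₂ fun m n : ℕ => m ^ n :=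
  (Primrec.nat_rec (Primrec.const 1)
    (Primrec.nat_mul.comp (Primrec.snd.comp Primrec.snd) Primrec.fst).to₂).of_eq fun m n => by
    induction n with
    | zero => rfl
    | succ n ih => rw [pow_succ, ← ih]

theorem primrec_replicate : Primrec₂ fun (n : ℕ) (b : β) => List.replicate n b :=
  (Primrec.list_map (Primrec.list_range.comp Primrec.fst)
    (Primrec.snd.comp Primrec.fst).to₂).of_eq fun x => by
    simp [List.map_const']

theorem primrecPred_mem {f : α → β} {g : α → List β} (hf : Primrec f) (hg : Primrec g) :
    PrimrecPred fun a => f a ∈ g a := by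
  have h : PrimrecRel fun (L : List β) (b : β) => ∃ a ∈ L, a = b :=
    PrimrecRel.exists_mem_list Primrec.eq
  exact (h.comp hg hf).of_eq fun a => by simp

theorem primrec_dedup [DecidableEq β] : Primrec fun L : List β => L.dedup := by
  have h : Primrec fun L : List β =>
      L.foldr (fun b acc => if b ∈ acc then acc else b :: acc) [] :=
    Primrec.list_foldr Primrec.id (Primrec.const [])
      (Primrec.ite (primrecPred_mem (Primrec.fst.comp Primrec.snd) (Primrec.snd.comp Primrec.snd))
        (Primrec.snd.comp Primrec.snd)
        (Primrec.list_cons.comp (Primrec.fst.comp Primrec.snd) (Primrec.snd.comp Primrec.snd))).to₂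
  refine h.of_eq fun L => ?_
  induction L with
  | nil => rfl
  | cons b L ih =>
    rw [List.foldr_cons, ih]
    by_cases hb : b ∈ L
    · rw [if_pos (List.mem_dedup.2 hb), List.dedup_cons_of_mem hb]
    · rw [if_neg (mt List.mem_dedup.1 hb), List.dedup_cons_of_notMem hb]

theorem primrec_count [BEq β] [LawfulBEq β] [DecidableEq β] : Primrec₂ fun (b : β) (L : List β) => L.count b :=
  (Primrec.list_length.comp (primrec_filter (p := fun (x : β × List β) b => b = x.1) Primrec.snd
    (Primrec.eq.comp Primrec.snd (Primrec.fst.comp Primrec.fst)))).of_eq fun x => by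
    simp only [List.count_eq_countP, List.countP_eq_length_filter]
    congr 1
    exact List.filter_congr fun b _ => by rw [beq_eq_decide]

/-- The primed enumeration is a plain right fold, hence primitive recursive at once; the same holds
for `List.permutations'` below. -/
theorem primrec_sublists' : Primrec fun L : List β => L.sublists' := by
  have h : Primrec fun L : List β => L.foldr (fun b acc => acc ++ acc.map (List.cons b)) [[]] :=
    Primrec.list_foldr Primrec.id (Primrec.const [[]])
      (Primrec.list_append.comp (Primrec.snd.comp Primrec.snd)
        (Primrec.list_map (Primrec.snd.comp Primrec.snd)
          (Primrec.list_cons.comp (Primrec.fst.comp (Primrec.snd.comp Primrec.fst))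
            Primrec.snd).to₂)).to₂
  refine h.of_eq fun L => ?_
  induction L with
  | nil => rfl
  | cons b L ih => rw [List.foldr_cons, ih, List.sublists'_cons]

theorem primrec_permutations'Aux : Primrec₂ fun (b : β) (L : List β) => L.permutations'Aux b := by
  have h : Primrec fun x : β × List β => List.rec (motive := fun _ => List (List β)) [[x.1]]
      (fun y ys ih => (x.1 :: y :: ys) :: ih.map (List.cons y)) x.2 :=
    Primrec.list_rec (h := fun (x : β × List β) (t : β × List β × List (List β)) =>
        (x.1 :: t.1 :: t.2.1) :: t.2.2.map (List.cons t.1)) Primrec.snd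
      (Primrec.list_cons.comp (Primrec.list_cons.comp Primrec.fst (Primrec.const []))
        (Primrec.const []))
      (Primrec.list_cons.comp
        (Primrec.list_cons.comp (Primrec.fst.comp Primrec.fst)
          (Primrec.list_cons.comp (Primrec.fst.comp Primrec.snd)
            (Primrec.fst.comp (Primrec.snd.comp Primrec.snd))))
        (Primrec.list_map (Primrec.snd.comp (Primrec.snd.comp Primrec.snd))
          (Primrec.list_cons.comp (Primrec.fst.comp (Primrec.snd.comp Primrec.fst))
            Primrec.snd).to₂)).to₂
  refine h.of_eq fun x => ?_
  obtain ⟨b, L⟩ := x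
  induction L with
  | nil => rfl
  | cons y L ih => simpa using congrArg (List.map (List.cons y)) ih

theorem primrec_permutations' : Primrec fun L : List β => L.permutations' := by
  have h : Primrec fun L : List β =>
      L.foldr (fun b acc => acc.flatMap (List.permutations'Aux b)) [[]] :=
    Primrec.list_foldr Primrec.id (Primrec.const [[]])
      (Primrec.list_flatMap (Primrec.snd.comp Primrec.snd)
        (primrec_permutations'Aux.comp (Primrec.fst.comp (Primrec.snd.comp Primrec.fst))
          Primrec.snd).to₂).to₂
  refine h.of_eq fun L => ?_
  induction L with
  | nil => rfl
  | cons b L ih => rw [List.foldr_cons, ih, List.permutations']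

theorem primrec_argminOn {c : α → β → ℕ} {d : α → β} {l : α → List β}
    (hc : Primrec₂ c) (hd : Primrec d) (hl : Primrec l) :
    Primrec fun a => argminOn (c a) (d a) (l a) :=
  Primrec.list_foldl hl hd
    (Primrec.ite (Primrec.nat_lt.comp (hc.comp Primrec.fst (Primrec.snd.comp Primrec.snd))
        (hc.comp Primrec.fst (Primrec.fst.comp Primrec.snd)))
      (Primrec.snd.comp Primrec.snd) (Primrec.fst.comp Primrec.snd)).to₂

end Primrec

/-! ### Primitive recursiveness of the procedures of the algorithm -/

theorem primrec_natDist : Primrec₂ natDist := by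
  have hx : Primrec fun z : Point × Point => z.1.1 := Primrec.fst.comp Primrec.fst
  have hx' : Primrec fun z : Point × Point => z.1.2 := Primrec.snd.comp Primrec.fst
  have hy : Primrec fun z : Point × Point => z.2.1 := Primrec.fst.comp Primrec.snd
  have hy' : Primrec fun z : Point × Point => z.2.2 := Primrec.snd.comp Primrec.snd
  exact Primrec.nat_add.comp
    (Primrec.nat_add.comp (Primrec.nat_sub.comp hx hy) (Primrec.nat_sub.comp hy hx))
    (Primrec.nat_add.comp (Primrec.nat_sub.comp hx' hy') (Primrec.nat_sub.comp hy' hx'))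

theorem primrec_nearest : Primrec₂ nearest :=
  primrec_argminOn (c := fun (x : List Point × Point) r => natDist x.2 r)
    (primrec_natDist.comp (Primrec.snd.comp Primrec.fst) Primrec.snd) (Primrec.const (0, 0))
    Primrec.fst

theorem primrec_snapCost : Primrec₂ snapCost :=
  primrec_sum (Primrec.list_map Primrec.fst (primrec_natDist.comp Primrec.snd
    (primrec_nearest.comp (Primrec.snd.comp Primrec.fst) Primrec.snd)))

theorem primrec_bestReps : Primrec₂ bestReps :=
  primrec_argminOn (c := fun (x : ℕ × List Point) R => snapCost x.2 R)
    (primrec_snapCost.comp (Primrec.snd.comp Primrec.fst) Primrec.snd) (Primrec.const [])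
    (primrec_filter (p := fun (x : ℕ × List Point) R => R.length < x.1)
      (primrec_sublists'.comp Primrec.snd)
      (Primrec.nat_lt.comp (Primrec.list_length.comp Primrec.snd)
        (Primrec.fst.comp Primrec.fst)))

theorem primrec_invPrec : Primrec invPrec :=
  Primrec.succ.comp (Primrec.nat_div.comp
    (Primrec.snd.comp (Primrec.snd.comp Primrec.snd))
    (Primrec.fst.comp (Primrec.snd.comp Primrec.snd)))

theorem primrec_capacity : Primrec₂ capacity :=
  Primrec.nat_mul.comp (Primrec.nat_mul.comp
    (Primrec.nat_mul.comp (Primrec.const 1157) (Primrec.fst.comp Primrec.fst))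
    (primrec_pow.comp (primrec_invPrec.comp Primrec.fst) (Primrec.const 2)))
    (primrec_pow.comp (Primrec.const 8) Primrec.snd)

theorem primrec_epoch : Primrec epoch :=
  Primrec.nat_findGreatest (p := fun t a => a = 0 ∨ 2 ^ 2 ^ (a - 1) ≤ t) Primrec.id
    ((Primrec.eq.comp Primrec.snd (Primrec.const 0)).or
      (Primrec.nat_le.comp (primrec_pow.comp (Primrec.const 2)
        (primrec_pow.comp (Primrec.const 2)
          (Primrec.nat_sub.comp Primrec.snd (Primrec.const 1)))) Primrec.fst))

theorem primrecPred_level {α : Type*} [Primcodable α] {a i : α → ℕ} {z : α → Cell}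
    (ha : Primrec a) (hi : Primrec i) (hz : Primrec z) :
    PrimrecPred fun x => (z x).1 = a x ∧ (z x).2.1 = i x :=
  (Primrec.eq.comp (Primrec.fst.comp hz) ha).and
    (Primrec.eq.comp (Primrec.fst.comp (Primrec.snd.comp hz)) hi)

theorem primrec_pointsAt {α : Type*} [Primcodable α] {a i : α → ℕ} {L : α → List Cell}
    (ha : Primrec a) (hi : Primrec i) (hL : Primrec L) :
    Primrec fun x => pointsAt (a x) (i x) (L x) :=
  Primrec.list_map (primrec_filter (p := fun x z => z.1 = a x ∧ z.2.1 = i x) hL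
    (primrecPred_level (ha.comp Primrec.fst) (hi.comp Primrec.fst) Primrec.snd))
    (Primrec.snd.comp (Primrec.snd.comp Primrec.snd))

theorem primrec_snapCell {α : Type*} [Primcodable α] {a i : α → ℕ} {R : α → List Point}
    {z : α → Cell} (ha : Primrec a) (hi : Primrec i) (hR : Primrec R) (hz : Primrec z) :
    Primrec fun x => snapCell (a x) (i x) (R x) (z x) :=
  Primrec.ite (primrecPred_level ha hi hz)
    (Primrec.pair ha (Primrec.pair (Primrec.succ.comp hi)
      (primrec_nearest.comp hR (Primrec.snd.comp (Primrec.snd.comp hz))))) hz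

theorem primrec_compress {α : Type*} [Primcodable α] {P : α → ParamTuple} {a i : α → ℕ}
    {L : α → List Cell} (hP : Primrec P) (ha : Primrec a) (hL : Primrec L) (hi : Primrec i) :
    Primrec fun x => compress (P x) (a x) (L x) (i x) := by
  have hY := primrec_pointsAt ha hi hL
  have hc := primrec_capacity.comp hP ha
  have hR := primrec_bestReps.comp hc hY
  exact Primrec.ite (Primrec.nat_lt.comp (Primrec.nat_mul.comp (Primrec.const 2) hc)
      (Primrec.list_length.comp (primrec_dedup.comp hY)))
    (Primrec.list_map hL (primrec_snapCell (ha.comp Primrec.fst) (hi.comp Primrec.fst)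
      (hR.comp Primrec.fst) Primrec.snd)) hL

theorem primrec_insertPoint {α : Type*} [Primcodable α] {P : α → ParamTuple}
    {L : α → List Cell} {y : α → Point} (hP : Primrec P) (hL : Primrec L) (hy : Primrec y) :
    Primrec fun x => insertPoint (P x) (L x) (y x) := by
  have ha : Primrec fun x => epoch ((L x).length + 1) :=
    primrec_epoch.comp (Primrec.succ.comp (Primrec.list_length.comp hL))
  exact Primrec.list_foldl (Primrec.list_range.comp (primrec_pow.comp (Primrec.const 2) ha))
    (Primrec.list_cons.comp (Primrec.pair ha (Primrec.pair (Primrec.const 0) hy)) hL)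
    (primrec_compress (hP.comp Primrec.fst) (ha.comp Primrec.fst)
      (Primrec.fst.comp Primrec.snd) (Primrec.snd.comp Primrec.snd)).to₂

theorem primrec_compact : Primrec compact :=
  Primrec.list_map primrec_dedup (Primrec.encode.comp
    (Primrec.pair (primrec_count.comp Primrec.snd Primrec.fst) Primrec.snd))

theorem primrec_expand : Primrec expand := by
  have h : Primrec fun x : List ℕ × ℕ => Denumerable.ofNat (ℕ × ℕ × Cell) x.2 :=
    (Primrec.ofNat _).comp Primrec.snd
  exact Primrec.list_flatMap Primrec.id
    (primrec_replicate.comp (Primrec.fst.comp h) (Primrec.snd.comp h))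

theorem primrec_labelled : Primrec₂ labelled :=
  Primrec.list_map (primrec_filter (p := fun (x : ℕ × List (ℕ × Cell)) z => z.1 = x.1) Primrec.snd
    (Primrec.eq.comp (Primrec.fst.comp Primrec.snd) (Primrec.fst.comp Primrec.fst)))
    (Primrec.snd.comp Primrec.snd)

theorem primrec_storedPoints : Primrec₂ storedPoints :=
  Primrec.list_map (primrec_labelled.comp Primrec.fst (primrec_expand.comp Primrec.snd))
    (Primrec.snd.comp (Primrec.snd.comp Primrec.snd))

theorem primrec_replaceLabel {α : Type*} [Primcodable α] {b : α → ℕ} {L : α → List (ℕ × Cell)}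
    {N : α → List Cell} (hb : Primrec b) (hL : Primrec L) (hN : Primrec N) :
    Primrec fun x => ((L x).filter fun z => ¬ z.1 = b x) ++ (N x).map fun z => (b x, z) :=
  Primrec.list_append.comp
    (primrec_filter (p := fun x z => ¬ z.1 = b x) hL
      (Primrec.eq.comp (Primrec.fst.comp Primrec.snd) (hb.comp Primrec.fst)).not)
    (Primrec.list_map hN (Primrec.pair (hb.comp Primrec.fst) Primrec.snd).to₂)

theorem primrec_nextMemory :
    Primrec fun x : ParamTuple × List ℕ × Item => nextMemory x.1 x.2.1 x.2.2 := by
  have hE : Primrec fun x : ParamTuple × List ℕ × Item => expand x.2.1 :=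
    primrec_expand.comp (Primrec.fst.comp Primrec.snd)
  have hb : Primrec fun x : ParamTuple × List ℕ × Item => x.2.2.1.toNat :=
    (Primrec.dom_finite Bool.toNat).comp (Primrec.fst.comp (Primrec.snd.comp Primrec.snd))
  have hN := primrec_insertPoint Primrec.fst (primrec_labelled.comp hb hE)
    (Primrec.snd.comp (Primrec.snd.comp Primrec.snd))
  have hq : PrimrecPred fun x : ParamTuple × List ℕ × Item => x.1.2.2.2 ≤ x.1.2.2.1 :=
    Primrec.nat_le.comp
      (Primrec.snd.comp (Primrec.snd.comp (Primrec.snd.comp Primrec.fst)))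
      (Primrec.fst.comp (Primrec.snd.comp (Primrec.snd.comp Primrec.fst)))
  exact Primrec.ite hq (Primrec.const [])
    (primrec_compact.comp (primrec_replaceLabel hb hE hN))

theorem primrec_alignCost : Primrec₂ alignCost :=
  primrec_sum (Primrec.list_map
    (Primrec.list_range.comp (Primrec.list_length.comp Primrec.fst))
    (primrec_natDist.comp
      (Primrec.list_getI.comp (Primrec.fst.comp Primrec.fst) Primrec.snd)
      (Primrec.list_getI.comp (Primrec.snd.comp Primrec.fst) Primrec.snd)))

theorem primrec_minCost : Primrec₂ minCost :=
  primrec_alignCost.comp Primrec.fst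
    (primrec_argminOn (c := fun (x : List Point × List Point) T => alignCost x.1 T)
      (primrec_alignCost.comp (Primrec.fst.comp Primrec.fst) Primrec.snd) Primrec.snd
      (primrec_permutations'.comp Primrec.snd))

theorem primrec_finalEstimate :
    Primrec fun x : ParamTuple × List ℕ => finalEstimate x.1 x.2 :=
  Primrec.ite (Primrec.nat_le.comp
      (Primrec.snd.comp (Primrec.snd.comp (Primrec.snd.comp Primrec.fst)))
      (Primrec.fst.comp (Primrec.snd.comp (Primrec.snd.comp Primrec.fst))))
    (Primrec.const 0)
    (primrec_minCost.comp (primrec_storedPoints.comp (Primrec.const 1) Primrec.snd)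
      (primrec_storedPoints.comp (Primrec.const 0) Primrec.snd))

/-- The streaming algorithm. -/
def algorithm : StreamingAlgorithm where
  init _ := []
  update := nextMemory
  output := finalEstimate
  computable_init := Computable.const []
  computable_update := primrec_nextMemory.to_comp
  computable_output := primrec_finalEstimate.to_comp

/-! ### Distances, minimisers, couplings -/

theorem natDist_cast (x y : Point) : (natDist x y : ℝ) = l1Dist x y := by
  have h (a b : ℕ) : ((a - b + (b - a) : ℕ) : ℝ) = |(a : ℝ) - b| := by
    rcases le_total a b with h | h
    · rw [Nat.sub_eq_zero_of_le h, zero_add, Nat.cast_sub h, abs_sub_comm,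
        abs_of_nonneg (sub_nonneg.2 (Nat.cast_le.2 h))]
    · rw [Nat.sub_eq_zero_of_le h, add_zero, Nat.cast_sub h,
        abs_of_nonneg (sub_nonneg.2 (Nat.cast_le.2 h))]
  rw [natDist, Nat.cast_add, h, h, l1Dist]

theorem natDist_self (x : Point) : natDist x x = 0 := by simp [natDist]

theorem natDist_comm (x y : Point) : natDist x y = natDist y x := by
  unfold natDist; omega

theorem natDist_triangle (x y z : Point) : natDist x z ≤ natDist x y + natDist y z := by
  unfold natDist; omega

theorem eq_of_natDist_eq_zero {x y : Point} (h : natDist x y = 0) : x = y := by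
  unfold natDist at h; ext <;> omega

section argminOn

variable {β : Type*} (c : β → ℕ)

theorem argminOn_mem (d : β) (l : List β) : argminOn c d l ∈ d :: l := by
  unfold argminOn
  induction l generalizing d with
  | nil => simp
  | cons a l ih =>
    rw [List.foldl_cons]
    have := ih (if c a < c d then a else d)
    split_ifs at this ⊢ <;> simp only [List.mem_cons] at this ⊢ <;> tauto

theorem argminOn_le {d x : β} {l : List β} (hx : x ∈ d :: l) : c (argminOn c d l) ≤ c x := by
  unfold argminOn
  induction l generalizing d x with
  | nil => simp_all
  | cons a l ih =>
    rw [List.foldl_cons]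
    have h1 := ih (d := if c a < c d then a else d) List.mem_cons_self
    rcases List.mem_cons.1 hx with rfl | hx
    · exact h1.trans (by split_ifs <;> omega)
    · rcases List.mem_cons.1 hx with rfl | hx
      · exact h1.trans (by split_ifs <;> omega)
      · exact ih (List.mem_cons_of_mem _ hx)

end argminOn

/-! ### Couplings and the exhaustive computation of the EMD -/

/-- The cost of a coupling of two multisets of points. -/
def couplingCost (C : Multiset (Point × Point)) : ℕ := (C.map fun z => natDist z.1 z.2).sum

/-- The occurrences of pairs in `C` index both marginals, which gives a bijection between them of
exactly this cost. With `exists_coupling`, bijections can be replaced by multisets of pairs. -/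
theorem emd_map_le (C : Multiset (Point × Point)) :
    emd (C.map Prod.fst) (C.map Prod.snd) ≤ couplingCost C := by
  have h := ciInf_le (Set.finite_range fun π : (C.map Prod.fst).ToType ≃ (C.map Prod.snd).ToType =>
    ∑ a : (C.map Prod.fst).ToType, l1Dist a.1 (π a).1).bddBelow
    ((C.mapEquiv Prod.fst).symm.trans (C.mapEquiv Prod.snd))
  refine h.trans (le_of_eq ?_)
  refine (Equiv.sum_comp (C.mapEquiv Prod.fst) _).symm.trans ?_
  rw [couplingCost, ← Multiset.map_univ C fun z => natDist z.1 z.2]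
  rw [show (Finset.univ.val.map fun z : C.ToType => natDist z.1.1 z.1.2).sum =
    ∑ z : C.ToType, natDist z.1.1 z.1.2 from rfl, Nat.cast_sum]
  refine Finset.sum_congr rfl fun z _ => ?_
  rw [natDist_cast, Equiv.trans_apply, Equiv.symm_apply_apply, Multiset.mapEquiv_apply,
    Multiset.mapEquiv_apply]

theorem exists_coupling {S T : Multiset Point} (h : S.card = T.card) :
    ∃ C : Multiset (Point × Point), C.map Prod.fst = S ∧ C.map Prod.snd = T ∧
      emd S T = couplingCost C := by
  have : Nonempty (S.ToType ≃ T.ToType) :=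
    ⟨Fintype.equivOfCardEq (by rw [Multiset.card_coe, Multiset.card_coe, h])⟩
  obtain ⟨π, hπ⟩ := exists_eq_ciInf_of_finite
    (f := fun π : S.ToType ≃ T.ToType => ∑ a : S.ToType, l1Dist a.1 (π a).1)
  refine ⟨Finset.univ.val.map fun a : S.ToType => (a.1, (π a).1), ?_, ?_, ?_⟩
  · rw [Multiset.map_map]
    exact Multiset.map_univ_coe S
  · rw [Multiset.map_map]
    have h2 : (Finset.univ : Finset T.ToType).val = Finset.univ.val.map π := by
      rw [← Finset.map_univ_equiv π]; rfl
    conv_rhs => rw [← Multiset.map_univ_coe T, h2, Multiset.map_map]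
    rfl
  · rw [emd, ← hπ, couplingCost, Multiset.map_map]
    rw [show (Finset.univ.val.map ((fun z : Point × Point => natDist z.1 z.2) ∘
      fun a : S.ToType => (a.1, (π a).1))).sum = ∑ a : S.ToType, natDist a.1 (π a).1 from rfl,
      Nat.cast_sum]
    exact Finset.sum_congr rfl fun a _ => (natDist_cast _ _).symm

/-- Discrete gluing of couplings along a common marginal, pair by pair; this is what the triangle
inequality for `emd` needs. -/
theorem exists_glue {α β γ : Type*} (C : Multiset (α × β)) :
    ∀ C' : Multiset (β × γ), C.map Prod.snd = C'.map Prod.fst →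
    ∃ G : Multiset (α × β × γ), G.map (fun z => (z.1, z.2.1)) = C ∧ G.map Prod.snd = C' := by
  induction C using Multiset.induction with
  | empty => intro C' h; exact ⟨0, rfl, (Multiset.map_eq_zero.1 h.symm).symm⟩
  | cons z C ih =>
    intro C' h
    have hz : z.2 ∈ C'.map Prod.fst := by rw [← h]; simp
    obtain ⟨w, hw, hwz⟩ := Multiset.mem_map.1 hz
    obtain ⟨C'', rfl⟩ := Multiset.exists_cons_of_mem hw
    rw [Multiset.map_cons, Multiset.map_cons, hwz, Multiset.cons_inj_right] at h
    obtain ⟨G, hG, hG'⟩ := ih C'' h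
    refine ⟨(z.1, w) ::ₘ G, ?_, by rw [Multiset.map_cons, hG']⟩
    rw [Multiset.map_cons, hG, hwz]

theorem emd_comm_le {S T : Multiset Point} (h : S.card = T.card) : emd T S ≤ emd S T := by
  obtain ⟨C, rfl, rfl, hC⟩ := exists_coupling h
  have := emd_map_le (C.map Prod.swap)
  simp only [Multiset.map_map, couplingCost, Function.comp_def, Prod.fst_swap, Prod.snd_swap] at this
  rw [hC, couplingCost]
  simpa only [natDist_comm] using this

theorem emd_triangle {S T U : Multiset Point} (h : S.card = T.card) (h' : T.card = U.card) :
    emd S U ≤ emd S T + emd T U := by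
  obtain ⟨C, rfl, hT, hC⟩ := exists_coupling h
  obtain ⟨C', hT', rfl, hC'⟩ := exists_coupling h'
  obtain ⟨G, rfl, rfl⟩ := exists_glue C C' (hT.trans hT'.symm)
  have := emd_map_le (G.map fun z => (z.1, z.2.2))
  rw [hC, hC']
  simp only [Multiset.map_map, couplingCost, Function.comp_def] at this ⊢
  refine this.trans ?_
  rw [← Nat.cast_add, ← Multiset.sum_map_add]
  exact Nat.cast_le.2 (Multiset.sum_map_le_sum_map _ _ fun z _ => natDist_triangle _ _ _)

theorem emd_nonneg (S T : Multiset Point) : 0 ≤ emd S T :=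
  Real.iInf_nonneg fun _ => Finset.sum_nonneg fun _ _ => by unfold l1Dist; positivity

theorem alignCost_map (l : List (Point × Point)) :
    alignCost (l.map Prod.fst) (l.map Prod.snd) = (l.map fun z => natDist z.1 z.2).sum := by
  induction l with
  | nil => rfl
  | cons z l ih =>
    rw [List.map_cons, List.map_cons, List.map_cons, List.sum_cons, ← ih]
    simp [alignCost, List.range_succ_eq_map, Function.comp_def]

theorem emd_le_alignCost {S T : List Point} (h : S.length = T.length) :
    emd S T ≤ alignCost S T := by
  have := emd_map_le (S.zip T : Multiset (Point × Point))
  rw [Multiset.map_coe, Multiset.map_coe, List.map_fst_zip h.le, List.map_snd_zip h.ge] at this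
  refine this.trans (le_of_eq ?_)
  rw [couplingCost, Multiset.map_coe, Multiset.sum_coe, ← alignCost_map, List.map_fst_zip h.le,
    List.map_snd_zip h.ge]

/-- An optimal coupling can be listed in the given order of `S`; its second column is then one of
the permutations that `minCost` tries. -/
theorem exists_list_map_fst {β γ : Type*} (S : List β) :
    ∀ C : Multiset (β × γ), C.map Prod.fst = S →
    ∃ l : List (β × γ), (l : Multiset (β × γ)) = C ∧ l.map Prod.fst = S := by
  induction S with
  | nil => intro C h; exact ⟨[], (Multiset.map_eq_zero.1 h).symm, rfl⟩
  | cons x S ih =>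
    intro C h
    have hx : x ∈ C.map Prod.fst := by rw [h]; simp
    obtain ⟨w, hw, rfl⟩ := Multiset.mem_map.1 hx
    obtain ⟨C', rfl⟩ := Multiset.exists_cons_of_mem hw
    rw [Multiset.map_cons, ← Multiset.cons_coe, Multiset.cons_inj_right] at h
    obtain ⟨l, rfl, hl⟩ := ih C' h
    exact ⟨w :: l, rfl, by rw [List.map_cons, hl]⟩

theorem minCost_eq_emd {S T : List Point} (h : S.length = T.length) :
    (minCost S T : ℝ) = emd S T := by
  apply le_antisymm
  · obtain ⟨C, hS, hT, hC⟩ := exists_coupling (S := S) (T := T) (by simpa using h)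
    rw [hC, Nat.cast_le]
    obtain ⟨l, rfl, rfl⟩ := exists_list_map_fst S C hS
    have hl : l.map Prod.snd ∈ T :: T.permutations' :=
      List.mem_cons_of_mem _ (List.mem_permutations'.2 (Multiset.coe_eq_coe.1 hT))
    refine (argminOn_le _ hl).trans (le_of_eq ?_)
    rw [alignCost_map]
    rfl
  · have hm := argminOn_mem (alignCost S) T T.permutations'
    have hp : (argminOn (alignCost S) T T.permutations').Perm T := by
      rcases List.mem_cons.1 hm with h | h
      · rw [h]
      · exact List.mem_permutations'.1 h
    rw [minCost, ← Multiset.coe_eq_coe.2 hp]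
    exact emd_le_alignCost (h.trans hp.length_eq.symm)

/-! ### Snapping points to few representatives -/

/-- One representative is picked in every nonempty class of `key`. -/
theorem exists_rep_of_key {κ : Type*} [DecidableEq κ] (Y : Multiset Point) (key : Point → κ)
    (Q : Finset κ) (hQ : ∀ y ∈ Y, key y ∈ Q) :
    ∃ f : Point → Point, (∀ y ∈ Y, f y ∈ Y ∧ key (f y) = key y) ∧
      (Y.toFinset.image f).card ≤ Q.card := by
  classical
  have h : ∀ κ, ∃ r, ∀ y ∈ Y, key y = κ → r ∈ Y ∧ key r = κ := fun κ => by
    by_cases h : ∃ y ∈ Y, key y = κ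
    · obtain ⟨y, hy⟩ := h
      exact ⟨y, fun _ _ _ => hy⟩
    · exact ⟨(0, 0), fun y hy hk => (h ⟨y, hy, hk⟩).elim⟩
  choose r hr using h
  refine ⟨fun y => r (key y), fun y hy => hr _ y hy rfl, ?_⟩
  refine (Finset.card_le_card (t := Q.image r) ?_).trans Finset.card_image_le
  intro z hz
  obtain ⟨y, hy, rfl⟩ := Finset.mem_image.1 hz
  exact Finset.mem_image_of_mem _ (hQ y (Multiset.mem_toFinset.1 hy))

/-- The equal quotients place `a` and `b` in one bucket of width `s / m` in a grid anchored at `c`;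
the bound is multiplied by `m` to stay in the integers. -/
theorem mul_abs_sub_le_of_ediv_eq {a b c s m : ℤ} (hs : 0 < s) (hm : 0 ≤ m)
    (h : (a - c) * m / s = (b - c) * m / s) : m * |a - b| ≤ s := by
  have h1 := Int.emod_add_mul_ediv ((a - c) * m) s
  have h2 := Int.emod_add_mul_ediv ((b - c) * m) s
  have h3 := Int.emod_nonneg ((a - c) * m) hs.ne'
  have h4 := Int.emod_nonneg ((b - c) * m) hs.ne'
  have h5 := Int.emod_lt_of_pos ((a - c) * m) hs
  have h6 := Int.emod_lt_of_pos ((b - c) * m) hs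
  rw [h] at h1
  have h7 : m * (a - b) = (a - c) * m % s - (b - c) * m % s := by linarith
  calc m * |a - b| = |m * (a - b)| := by rw [abs_mul, abs_of_nonneg hm]
    _ ≤ s := by rw [h7, abs_le]; constructor <;> linarith

theorem ediv_mem_Icc {x s m : ℤ} (hs : 0 < s) (h : |x| ≤ m * s) :
    x / s ∈ Finset.Icc (-m) m := by
  rw [abs_le] at h
  rw [Finset.mem_Icc]
  constructor
  · rw [Int.le_ediv_iff_mul_le hs]; linarith
  · exact Int.ediv_le_of_le_mul hs h.2

theorem natDist_eq_abs (x y : Point) :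
    (natDist x y : ℤ) = |(x.1 : ℤ) - y.1| + |(x.2 : ℤ) - y.2| := by
  have h (a b : ℕ) : ((a - b + (b - a) : ℕ) : ℤ) = |(a : ℤ) - b| := by
    rcases abs_cases ((a : ℤ) - b) with h | h <;> omega
  rw [natDist, Nat.cast_add, h, h]

/-- Let `V` be the total distance to the centers and `N` the number of points. A point in ring `j`
of its center is at distance less than `2 ^ (j + 1) * V / N`. The ring is cut into cells of side `2
^ j * V / (4 * E * N)`, so there are at most `17 * E` indices per coordinate, and `289 = 17 ^ 2`.
Moves within a cell cost at most `1 / (2 * E)` times `V / N` plus the distance to the center, and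
both terms sum to `V`. -/
theorem exists_snap (K : Finset Point) (c : Point → Point) (hc : ∀ y, c y ∈ K)
    (Y : Multiset Point) {L E : ℕ} (hE : 0 < E) (hL : Y.card < 2 ^ L) :
    ∃ f : Point → Point, (∀ y ∈ Y, f y ∈ Y) ∧
      (Y.toFinset.image f).card ≤ 289 * K.card * L * E ^ 2 ∧
      E * (Y.map fun y => natDist y (f y)).sum ≤ (Y.map fun y => natDist y (c y)).sum := by
  rcases Y.empty_or_exists_mem with rfl | ⟨y₀, hy₀⟩
  · exact ⟨id, by simp⟩
  have hN : 0 < Y.card := Multiset.card_pos_iff_exists_mem.2 ⟨y₀, hy₀⟩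
  have hL0 : 0 < L := by
    rcases Nat.eq_zero_or_pos L with rfl | h
    · rw [pow_zero] at hL; omega
    · exact h
  have hle : ∀ y ∈ Y, natDist y (c y) ≤ (Y.map fun y => natDist y (c y)).sum := fun y hy =>
    Multiset.single_le_sum (fun _ _ => Nat.zero_le _) _ (Multiset.mem_map_of_mem _ hy)
  set V := (Y.map fun y => natDist y (c y)).sum with hV
  -- `V` is a divisor below. If it vanishes, all points are centers and nothing needs to move.
  rcases Nat.eq_zero_or_pos V with hV0 | hVpos
  · refine ⟨id, fun y hy => hy, ?_, by simp [natDist_self]⟩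
    rw [Finset.image_id]
    calc Y.toFinset.card ≤ K.card := Finset.card_le_card fun y hy => by
            have h0 := hle y (Multiset.mem_toFinset.1 hy)
            rw [hV0] at h0
            rw [eq_of_natDist_eq_zero (Nat.le_zero.1 h0)]
            exact hc y
      _ ≤ K.card * (289 * L * E ^ 2) := Nat.le_mul_of_pos_right _ (by positivity)
      _ = _ := by ring
  set N := Y.card with hNdef
  -- Since `Nat.log 2 0 = 0`, ring 0 also contains the points closer than the average `V / N`. No
  -- distance exceeds `V`, so the quotient is at most `N < 2 ^ L` and there are at most `L` rings.
  set j : Point → ℕ := fun y => Nat.log 2 (natDist y (c y) * N / V) with hj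
  set s : Point → ℤ := fun y => 2 ^ j y * V with hs
  have hspos : ∀ y, 0 < s y := fun y => by simp only [hs]; positivity
  set key : Point → Point × ℕ × ℤ × ℤ := fun y =>
    (c y, j y, ((y.1 : ℤ) - (c y).1) * (4 * E * N) / s y,
      ((y.2 : ℤ) - (c y).2) * (4 * E * N) / s y) with hkey
  have hbound : ∀ y, ((natDist y (c y) : ℕ) : ℤ) * (4 * E * N) ≤ 8 * E * s y := fun y => by
    have h1 : natDist y (c y) * N / V < 2 ^ (j y + 1) := Nat.lt_pow_succ_log_self one_lt_two _
    have h2 : natDist y (c y) * N < 2 ^ (j y + 1) * V := (Nat.div_lt_iff_lt_mul hVpos).1 h1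
    have h3 : natDist y (c y) * (4 * E * N) ≤ 8 * E * (2 ^ j y * V) := by
      calc natDist y (c y) * (4 * E * N) = 4 * E * (natDist y (c y) * N) := by ring
        _ ≤ 4 * E * (2 ^ (j y + 1) * V) := Nat.mul_le_mul_left _ h2.le
        _ = _ := by ring
    simp only [hs]
    exact_mod_cast h3
  have hcell : ∀ y, ∀ x : ℤ, |x| ≤ natDist y (c y) →
      x * (4 * E * N) / s y ∈ Finset.Icc (-(8 * E : ℤ)) (8 * E) := fun y x hx => by
    refine ediv_mem_Icc (hspos y) ((le_of_eq ?_).trans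
      ((mul_le_mul_of_nonneg_right hx (by positivity)).trans (hbound y)))
    rw [abs_mul, abs_of_nonneg (by positivity : (0 : ℤ) ≤ 4 * E * N)]
  set Q : Finset (Point × ℕ × ℤ × ℤ) := K ×ˢ Finset.range L ×ˢ
    Finset.Icc (-(8 * E : ℤ)) (8 * E) ×ˢ Finset.Icc (-(8 * E : ℤ)) (8 * E) with hQ
  have hkeyQ : ∀ y ∈ Y, key y ∈ Q := fun y hy => by
    have habs := natDist_eq_abs y (c y)
    have h1 := abs_nonneg ((y.1 : ℤ) - (c y).1)
    have h2 := abs_nonneg ((y.2 : ℤ) - (c y).2)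
    simp only [hQ, Finset.mem_product, hkey]
    refine ⟨hc y, Finset.mem_range.2 ?_, hcell y _ (by linarith), hcell y _ (by linarith)⟩
    refine Nat.log_lt_of_lt_pow' hL0.ne' (lt_of_le_of_lt ?_ hL)
    refine Nat.div_le_of_le_mul ?_
    exact Nat.mul_le_mul_right _ (hle y hy)
  obtain ⟨f, hf, hcard⟩ := exists_rep_of_key Y key Q hkeyQ
  refine ⟨f, fun y hy => (hf y hy).1, hcard.trans ?_, ?_⟩
  · have hI : (Finset.Icc (-(8 * E : ℤ)) (8 * E)).card ≤ 17 * E := by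
      rw [Int.card_Icc]; omega
    simp only [hQ, Finset.card_product, Finset.card_range]
    calc K.card * (L * (_ * _)) ≤ K.card * (L * (17 * E * (17 * E))) := by gcongr
      _ = _ := by ring
  · have hmove : ∀ y ∈ Y, 2 * E * N * natDist y (f y) ≤ V + N * natDist y (c y) := by
      intro y hy
      have hk := (hf y hy).2
      simp only [hkey, Prod.mk.injEq] at hk
      obtain ⟨k1, k2, k3, k4⟩ := hk
      have hsy : s (f y) = s y := by simp only [hs, k2]
      rw [hsy, k1] at k3 k4
      have h3 := mul_abs_sub_le_of_ediv_eq (hspos y) (by positivity) k3.symm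
      have h4 := mul_abs_sub_le_of_ediv_eq (hspos y) (by positivity) k4.symm
      have h5 : ((2 * E * N * natDist y (f y) : ℕ) : ℤ) ≤ s y := by
        push_cast
        rw [natDist_eq_abs]
        linarith
      have h6 : 2 * E * N * natDist y (f y) ≤ 2 ^ j y * V := by
        simp only [hs] at h5
        exact_mod_cast h5
      refine h6.trans ?_
      -- The scale `2 ^ j * V` is at most `V` when the quotient is zero, and at most `N` times the
      -- distance to the center otherwise.
      by_cases h0 : natDist y (c y) * N / V = 0
      · simp only [hj, h0, Nat.log_zero_right]
        omega
      · have h7 : 2 ^ j y ≤ natDist y (c y) * N / V := Nat.pow_log_le_self 2 h0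
        have h8 := (Nat.le_div_iff_mul_le hVpos).1 h7
        linarith
    have hsum := Multiset.sum_map_le_sum_map _ _ hmove
    rw [Multiset.sum_map_mul_left, Multiset.sum_map_add, Multiset.sum_map_mul_left,
      Multiset.map_const', Multiset.sum_replicate, smul_eq_mul, ← hV] at hsum
    refine Nat.le_of_mul_le_mul_left (c := 2 * N) ?_ (by positivity)
    linarith

/-! ### The stored cells: number and range -/

theorem lt_two_pow_epoch (t : ℕ) : t < 2 ^ 2 ^ epoch t := by
  rcases (Nat.findGreatest_le (P := fun a => a = 0 ∨ 2 ^ 2 ^ (a - 1) ≤ t) t).lt_or_eq with h | h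
  · have := Nat.findGreatest_is_greatest (P := fun a => a = 0 ∨ 2 ^ 2 ^ (a - 1) ≤ t)
      (Nat.lt_succ_self _) h
    simp only [Nat.succ_eq_add_one, Nat.add_sub_cancel, not_or, not_le] at this
    exact this.2
  -- The bounded search stopped at its bound `t`, which is large enough.
  · have h' : epoch t = t := h
    rw [h']
    exact Nat.lt_two_pow_self.trans Nat.lt_two_pow_self |>.trans_le
      (Nat.pow_le_pow_right two_pos (le_refl _))

theorem epoch_le_self (t : ℕ) : epoch t ≤ t := Nat.findGreatest_le _

theorem epoch_mono {s t : ℕ} (h : s ≤ t) : epoch s ≤ epoch t :=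
  Nat.findGreatest_mono (fun _ ha => ha.imp id fun ha => ha.trans h) h

theorem two_pow_le_of_epoch_ne_zero {t : ℕ} (h : epoch t ≠ 0) : 2 ^ 2 ^ (epoch t - 1) ≤ t :=
  (Nat.findGreatest_of_ne_zero (P := fun a => a = 0 ∨ 2 ^ 2 ^ (a - 1) ≤ t) rfl h).resolve_left h

/-- The number of points that arrived in epoch `b`. -/
def epochCount (b : ℕ) (L : List Cell) : ℕ := L.countP fun z => z.1 = b

/-- The distinct cells of epoch `b`, each weighted exponentially in its level. -/
def potential (b : ℕ) (L : List Cell) : ℕ := ∑ z ∈ L.toFinset with z.1 = b, 2 ^ z.2.1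

/-- The number of distinct points in level `i` of epoch `b`. -/
def distinctAt (b i : ℕ) (L : List Cell) : ℕ := (pointsAt b i L).toFinset.card

/-- What holds for the stored cells at every moment. -/
structure StateInv (Δ : ℕ) (L : List Cell) : Prop where
  potential_le : ∀ b, potential b L ≤ epochCount b L
  epochCount_lt : ∀ b, epochCount b L < 2 ^ 2 ^ b
  -- Only upper bounds: a point may be snapped to the default `(0, 0)`, which lies outside the grid.
  grid : ∀ z ∈ L, z.2.2.1 ≤ Δ ∧ z.2.2.2 ≤ Δ
  epoch_le : ∀ z ∈ L, z.1 ≤ epoch L.length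

theorem StateInv.perm {Δ : ℕ} {L L' : List Cell} (h : StateInv Δ L) (hL : L.Perm L') :
    StateInv Δ L' where
  potential_le b := by
    have := h.potential_le b
    rwa [potential, epochCount, List.toFinset_eq_of_perm _ _ hL, hL.countP_eq] at this
  epochCount_lt b := by
    have := h.epochCount_lt b
    rwa [epochCount, hL.countP_eq] at this
  grid z hz := h.grid z (hL.mem_iff.2 hz)
  epoch_le z hz := hL.length_eq ▸ h.epoch_le z (hL.mem_iff.2 hz)

theorem StateInv.two_pow_le {Δ : ℕ} {L : List Cell} (h : StateInv Δ L) {z : Cell} (hz : z ∈ L) :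
    2 ^ z.2.1 ≤ epochCount z.1 L :=
  le_trans (Finset.single_le_sum (f := fun z : Cell => 2 ^ z.2.1)
    (s := L.toFinset.filter fun w => w.1 = z.1) (fun _ _ => Nat.zero_le _)
    (Finset.mem_filter.2 ⟨List.mem_toFinset.2 hz, rfl⟩)) (h.potential_le z.1)

/-- One cell of level `i` already contributes `2 ^ i` to the potential, which is below `2 ^ 2 ^ a`.
-/
theorem StateInv.level_lt {Δ : ℕ} {L : List Cell} (h : StateInv Δ L) {z : Cell} (hz : z ∈ L) :
    z.2.1 < 2 ^ z.1 :=
  (Nat.pow_lt_pow_iff_right one_lt_two).1 ((h.two_pow_le hz).trans_lt (h.epochCount_lt z.1))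

theorem mem_pointsAt {b i : ℕ} {L : List Cell} {y : Point} :
    y ∈ pointsAt b i L ↔ (b, i, y) ∈ L := by
  simp only [pointsAt, List.mem_map, List.mem_filter, decide_eq_true_eq]
  constructor
  · rintro ⟨⟨b', i', y'⟩, ⟨h, rfl, rfl⟩, rfl⟩; exact h
  · intro h; exact ⟨_, ⟨h, rfl, rfl⟩, rfl⟩

theorem StateInv.nil (Δ : ℕ) : StateInv Δ [] where
  potential_le b := by simp [potential]
  epochCount_lt b := by simp [epochCount]
  grid := by simp
  epoch_le := by simp

theorem StateInv.cons {Δ : ℕ} {L : List Cell} (h : StateInv Δ L) {y : Point}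
    (hy : y.1 ≤ Δ ∧ y.2 ≤ Δ) : StateInv Δ ((epoch (L.length + 1), 0, y) :: L) where
  potential_le b := by
    have := h.potential_le b
    rw [potential, epochCount] at this ⊢
    rw [List.toFinset_cons, Finset.filter_insert, List.countP_cons]
    by_cases hb : epoch (L.length + 1) = b
    · simp only [hb, if_true, decide_true]
      by_cases hm : ((b, 0, y) : Cell) ∈ L.toFinset.filter fun z => z.1 = b
      · rw [Finset.insert_eq_of_mem hm]; exact this.trans (Nat.le_succ _)
      · rw [Finset.sum_insert hm, pow_zero, add_comm]; exact Nat.add_le_add_right this 1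
    · simpa [hb] using this
  epochCount_lt b := by
    have := h.epochCount_lt b
    rw [epochCount] at this ⊢
    by_cases hb : epoch (L.length + 1) = b
    · exact (List.countP_le_length).trans_lt (hb ▸ lt_two_pow_epoch _)
    · simpa [hb] using this
  grid z hz := by
    rcases List.mem_cons.1 hz with rfl | hz
    · exact hy
    · exact h.grid z hz
  epoch_le z hz := by
    rcases List.mem_cons.1 hz with rfl | hz
    · exact le_refl _
    · exact (h.epoch_le z hz).trans (epoch_mono (Nat.le_succ _))

theorem snapCell_fst (a i : ℕ) (R : List Point) (z : Cell) : (snapCell a i R z).1 = z.1 := by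
  unfold snapCell; split_ifs with h
  · exact h.1.symm
  · rfl

theorem nearest_mem (R : List Point) (z : Point) : nearest R z ∈ (0, 0) :: R := argminOn_mem _ _ _

theorem bestReps_mem {m : ℕ} (hm : 0 < m) (Y : List Point) :
    (bestReps m Y).Sublist Y ∧ (bestReps m Y).length < m := by
  rcases List.mem_cons.1 (argminOn_mem (snapCost Y) [] (Y.sublists'.filter fun R => R.length < m))
    with h | h
  · rw [bestReps, h]; exact ⟨List.nil_sublist _, hm⟩
  · rw [bestReps]; simpa using h

/-- At least `2 * m` distinct cells of weight `2 ^ i` disappear and at most `m` of weight `2 ^ (i +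
1)` are created, so the potential does not grow. -/
theorem StateInv.map_snapCell {Δ : ℕ} {L : List Cell} (h : StateInv Δ L) {a i m : ℕ}
    {R : List Point} (hR : R.Sublist (pointsAt a i L)) (hm : R.length < m)
    (hd : 2 * m ≤ distinctAt a i L) : StateInv Δ (L.map (snapCell a i R)) where
  potential_le b := by
    have hcount : epochCount b (L.map (snapCell a i R)) = epochCount b L := by
      simp only [epochCount, List.countP_map, Function.comp_def, snapCell_fst]
    rw [hcount]
    refine le_trans ?_ (h.potential_le b)
    unfold potential
    by_cases hb : b = a
    · subst hb
      set N : Finset Cell := ((0, 0) :: R).toFinset.image fun y => (b, i + 1, y) with hN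
      have hsub : (L.map (snapCell b i R)).toFinset.filter (fun z => z.1 = b) ⊆
          (L.toFinset.filter fun z => z.1 = b).filter (fun z => z.2.1 ≠ i) ∪ N := by
        intro z hz
        simp only [Finset.mem_filter, List.mem_toFinset, List.mem_map] at hz
        obtain ⟨⟨w, hw, rfl⟩, hwb⟩ := hz
        rw [snapCell_fst] at hwb
        by_cases hi : w.2.1 = i
        · refine Finset.mem_union_right _ (Finset.mem_image.2 ⟨nearest R w.2.2,
            List.mem_toFinset.2 (nearest_mem _ _), ?_⟩)
          rw [snapCell, if_pos ⟨hwb, hi⟩]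
        · rw [snapCell, if_neg fun h => hi h.2]
          exact Finset.mem_union_left _ (by simp [hw, hwb, hi])
      have hsplit := Finset.sum_filter_add_sum_filter_not (L.toFinset.filter fun z => z.1 = b)
        (fun z => z.2.1 ≠ i) (fun z : Cell => 2 ^ z.2.1)
      have hold : distinctAt b i L * 2 ^ i ≤ ∑ z ∈ (L.toFinset.filter fun z => z.1 = b).filter
          (fun z => ¬ z.2.1 ≠ i), 2 ^ z.2.1 := by
        rw [Finset.sum_congr rfl (g := fun _ => 2 ^ i)
          (fun z hz => by rw [not_not.1 (Finset.mem_filter.1 hz).2]), Finset.sum_const,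
          smul_eq_mul]
        refine Nat.mul_le_mul_right _ ?_
        refine Finset.card_le_card_of_injOn (fun y => ((b, i, y) : Cell)) (fun y hy => ?_)
          (fun y _ y' _ hyy' => by simpa using hyy')
        have := mem_pointsAt.1 (List.mem_toFinset.1 hy)
        simp [this]
      have hnew : ∑ z ∈ N, 2 ^ z.2.1 ≤ m * 2 ^ (i + 1) := by
        rw [Finset.sum_congr rfl (g := fun _ => 2 ^ (i + 1)) (fun z hz => by
          obtain ⟨y, _, rfl⟩ := Finset.mem_image.1 hz; rfl), Finset.sum_const, smul_eq_mul]
        refine Nat.mul_le_mul_right _ (Finset.card_image_le.trans ?_)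
        -- The strict bound on `R.length` leaves room for the default point `(0, 0)`.
        exact (List.toFinset_card_le _).trans (by rw [List.length_cons]; omega)
      have h2 : m * 2 ^ (i + 1) ≤ distinctAt b i L * 2 ^ i := by
        rw [pow_succ]
        calc m * (2 ^ i * 2) = 2 * m * 2 ^ i := by ring
          _ ≤ _ := Nat.mul_le_mul_right _ hd
      refine (Finset.sum_le_sum_of_subset hsub).trans ?_
      refine (Nat.le_add_right _ _).trans ((Finset.sum_union_inter (f := fun z : Cell =>
        2 ^ z.2.1)).le.trans ?_)
      omega
    · refine Finset.sum_le_sum_of_subset fun z hz => ?_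
      simp only [Finset.mem_filter, List.mem_toFinset, List.mem_map] at hz ⊢
      obtain ⟨⟨w, hw, rfl⟩, hwb⟩ := hz
      rw [snapCell_fst] at hwb
      rw [snapCell, if_neg fun h => hb (hwb.symm.trans h.1)]
      exact ⟨hw, hwb⟩
  epochCount_lt b := by
    have := h.epochCount_lt b
    simpa only [epochCount, List.countP_map, Function.comp_def, snapCell_fst] using this
  grid z hz := by
    obtain ⟨w, hw, rfl⟩ := List.mem_map.1 hz
    unfold snapCell
    split_ifs
    · rcases List.mem_cons.1 (nearest_mem R w.2.2) with h0 | h0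
      · rw [h0]; exact ⟨Nat.zero_le _, Nat.zero_le _⟩
      · exact h.grid (a, i, nearest R w.2.2) (mem_pointsAt.1 (hR.subset h0))
    · exact h.grid w hw
  epoch_le z hz := by
    obtain ⟨w, hw, rfl⟩ := List.mem_map.1 hz
    rw [snapCell_fst, List.length_map]
    exact h.epoch_le w hw

theorem distinctAt_eq_length (a i : ℕ) (L : List Cell) :
    (pointsAt a i L).dedup.length = distinctAt a i L := (List.card_toFinset _).symm

theorem StateInv.compress {P : ParamTuple} {Δ : ℕ} {L : List Cell} (h : StateInv Δ L) {a i : ℕ}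
    (hP : 0 < capacity P a) : StateInv Δ (compress P a L i) := by
  unfold EMDStream.compress
  split_ifs with hd
  · rw [distinctAt_eq_length] at hd
    have := bestReps_mem hP (pointsAt a i L)
    exact h.map_snapCell this.1 this.2 hd.le
  · exact h

/-! ### Number of distinct points per level and in total -/

theorem distinctAt_mono {b j : ℕ} {L L' : List Cell}
    (h : ∀ y, (b, j, y) ∈ L' → (b, j, y) ∈ L) : distinctAt b j L' ≤ distinctAt b j L :=
  Finset.card_le_card fun y hy => by
    rw [List.mem_toFinset, mem_pointsAt] at hy ⊢
    exact h y hy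

theorem distinctAt_compress_le {P : ParamTuple} {L : List Cell} {a i b j : ℕ}
    (h : ¬ (b = a ∧ j = i + 1)) : distinctAt b j (compress P a L i) ≤ distinctAt b j L := by
  unfold compress
  split_ifs
  · refine distinctAt_mono fun y hy => ?_
    obtain ⟨w, hw, hwy⟩ := List.mem_map.1 hy
    unfold snapCell at hwy
    split_ifs at hwy with hc
    · simp only [Prod.mk.injEq] at hwy
      exact (h ⟨hwy.1.symm, hwy.2.1.symm⟩).elim
    · exact hwy ▸ hw
  · exact le_refl _

theorem distinctAt_compress_self {P : ParamTuple} {L : List Cell} {a i : ℕ} :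
    distinctAt a i (compress P a L i) ≤ 2 * capacity P a := by
  unfold compress
  split_ifs with hd
  · refine (Nat.le_of_eq ?_).trans (Nat.zero_le _)
    rw [distinctAt, Finset.card_eq_zero, Finset.eq_empty_iff_forall_notMem]
    intro y hy
    rw [List.mem_toFinset, mem_pointsAt] at hy
    obtain ⟨w, hw, hwy⟩ := List.mem_map.1 hy
    unfold snapCell at hwy
    split_ifs at hwy with hc
    · simp at hwy
    · exact hc (by rw [hwy]; exact ⟨rfl, rfl⟩)
  · rw [distinctAt_eq_length] at hd
    omega

/-- No level holds many distinct points. -/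
def Bounded (P : ParamTuple) (L : List Cell) : Prop :=
  ∀ b j, distinctAt b j L ≤ 2 * capacity P b

theorem Bounded.perm {P : ParamTuple} {L L' : List Cell} (h : Bounded P L) (hL : L.Perm L') :
    Bounded P L' := fun b j =>
  (distinctAt_mono fun _ hy => hL.mem_iff.2 hy).trans (h b j)

theorem length_compress (P : ParamTuple) (a : ℕ) (L : List Cell) (i : ℕ) :
    (compress P a L i).length = L.length := by
  unfold compress; split_ifs <;> simp

/-- Induction over the compressions caused by an insertion. -/
theorem insertPoint_induction {P : ParamTuple} {L : List Cell} {y : Point}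
    (p : ℕ → List Cell → Prop) (h0 : p 0 ((epoch (L.length + 1), 0, y) :: L))
    (hs : ∀ i L', p i L' → p (i + 1) (compress P (epoch (L.length + 1)) L' i)) :
    p (2 ^ epoch (L.length + 1)) (insertPoint P L y) := by
  unfold insertPoint
  generalize 2 ^ epoch (L.length + 1) = n
  induction n with
  | zero => exact h0
  | succ n ih => rw [List.range_succ, List.foldl_append]; exact hs _ _ ih

theorem length_insertPoint (P : ParamTuple) (L : List Cell) (y : Point) :
    (insertPoint P L y).length = L.length + 1 :=
  insertPoint_induction (fun _ L' => L'.length = L.length + 1) rfl fun i L' h => by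
    rw [length_compress, h]

theorem StateInv.insertPoint {P : ParamTuple} {Δ : ℕ} {L : List Cell} (h : StateInv Δ L)
    (hP : ∀ a, 0 < capacity P a) {y : Point} (hy : y.1 ≤ Δ ∧ y.2 ≤ Δ) :
    StateInv Δ (insertPoint P L y) :=
  insertPoint_induction (fun _ L' => StateInv Δ L') (h.cons hy) fun _ _ h => h.compress (hP _)

/-- The sweep goes upwards: a compression can overfill only the next level, which is treated next.
Levels from `2 ^ a` on are empty by `StateInv.level_lt`. -/
theorem Bounded.insertPoint {P : ParamTuple} {Δ : ℕ} {L : List Cell} (hL : StateInv Δ L)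
    (h : Bounded P L) (hP : ∀ a, 0 < capacity P a) {y : Point} (hy : y.1 ≤ Δ ∧ y.2 ≤ Δ) :
    Bounded P (insertPoint P L y) := by
  have key := insertPoint_induction (P := P) (L := L) (y := y)
    (fun n L' => ∀ b j, (b ≠ epoch (L.length + 1) ∨ j < n) → distinctAt b j L' ≤ 2 * capacity P b)
    (fun b j hb => (distinctAt_mono fun z hz => by
      rcases List.mem_cons.1 hz with hz | hz
      · simp only [Prod.mk.injEq] at hz
        rcases hb with hb | hb
        · exact (hb hz.1).elim
        · omega
      · exact hz).trans (h b j))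
    (fun i L' ih b j hb => by
      by_cases hbj : b = epoch (L.length + 1) ∧ j = i
      · rw [hbj.1, hbj.2]; exact distinctAt_compress_self
      · exact (distinctAt_compress_le (by omega)).trans (ih b j (by omega)))
  intro b j
  by_cases hb : b ≠ epoch (L.length + 1) ∨ j < 2 ^ epoch (L.length + 1)
  · exact key b j hb
  · push Not at hb
    refine (Nat.le_of_eq ?_).trans (Nat.zero_le _)
    rw [distinctAt, Finset.card_eq_zero, Finset.eq_empty_iff_forall_notMem]
    intro z hz
    rw [List.mem_toFinset, mem_pointsAt] at hz
    have := (hL.insertPoint hP hy).level_lt hz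
    rw [hb.1] at this
    exact absurd this (not_lt.2 hb.2)

theorem sum_sixteen_pow_le (A : ℕ) : ∑ a ∈ Finset.range (A + 1), 16 ^ a ≤ 2 * 16 ^ A := by
  induction A with
  | zero => simp
  | succ A ih => rw [Finset.sum_range_succ, pow_succ]; omega

theorem StateInv.card_toFinset_le {P : ParamTuple} {Δ : ℕ} {L : List Cell} (h : StateInv Δ L)
    (hb : Bounded P L) :
    L.toFinset.card ≤ 4628 * P.1 * invPrec P ^ 2 * 16 ^ epoch L.length := by
  have hsub : L.toFinset ⊆ (Finset.range (epoch L.length + 1)).biUnion fun a =>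
      (Finset.range (2 ^ a)).biUnion fun i =>
        (pointsAt a i L).toFinset.image fun y => ((a, i, y) : Cell) := by
    intro z hz
    rw [List.mem_toFinset] at hz
    simp only [Finset.mem_biUnion, Finset.mem_range, Finset.mem_image, List.mem_toFinset,
      mem_pointsAt]
    exact ⟨z.1, Nat.lt_succ_of_le (h.epoch_le z hz), z.2.1, h.level_lt hz, z.2.2, hz, rfl⟩
  calc L.toFinset.card
      ≤ ∑ a ∈ Finset.range (epoch L.length + 1), ∑ i ∈ Finset.range (2 ^ a), 2 * capacity P a :=
        (Finset.card_le_card hsub).trans <| Finset.card_biUnion_le.trans <|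
          Finset.sum_le_sum fun a _ => Finset.card_biUnion_le.trans <|
            Finset.sum_le_sum fun i _ => Finset.card_image_le.trans (hb a i)
    _ = 2314 * P.1 * invPrec P ^ 2 * ∑ a ∈ Finset.range (epoch L.length + 1), 16 ^ a := by
        rw [Finset.mul_sum]
        refine Finset.sum_congr rfl fun a _ => ?_
        rw [Finset.sum_const, Finset.card_range, smul_eq_mul, capacity,
          show (16 : ℕ) = 2 * 8 by norm_num, mul_pow]
        ring
    _ ≤ 2314 * P.1 * invPrec P ^ 2 * (2 * 16 ^ epoch L.length) :=
        Nat.mul_le_mul_left _ (sum_sixteen_pow_le _)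
    _ = _ := by ring

/-! ### The cost of moving the points to the stored cells -/

/-- The sum of `φ` over the pairs whose cell lies in level `i` of epoch `a`. -/
def levelSum (φ : Point × Cell → ℕ) (a i : ℕ) (G : Multiset (Point × Cell)) : ℕ :=
  (G.map fun g => if g.2.1 = a ∧ g.2.2.1 = i then φ g else 0).sum

/-- The distance of the point to its cell plus its distance to the centers. -/
def pathCost (c : Point → Point) (g : Point × Cell) : ℕ :=
  natDist g.1 g.2.2.2 + natDist g.1 (c g.1)

/-- The distance of the point to the centers. -/
def centerCost (c : Point → Point) (g : Point × Cell) : ℕ := natDist g.1 (c g.1)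

/-- The points of `T` are coupled with the cells `L` at small cost relative to the centers `c`. -/
def CostInv (P : ParamTuple) (c : Point → Point) (T : Multiset Point) (L : List Cell) : Prop :=
  ∃ G : Multiset (Point × Cell), G.map Prod.fst = T ∧ G.map Prod.snd = (L : Multiset Cell) ∧
    ∀ a i, invPrec P * 2 ^ a * levelSum (pathCost c) a i G ≤
      (invPrec P * 2 ^ a + i) * levelSum (centerCost c) a i G

theorem CostInv.perm {P : ParamTuple} {c : Point → Point} {T : Multiset Point} {L L' : List Cell}
    (h : CostInv P c T L) (hL : L.Perm L') : CostInv P c T L' := by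
  rwa [CostInv, ← Multiset.coe_eq_coe.2 hL]

theorem CostInv.nil (P : ParamTuple) (c : Point → Point) : CostInv P c 0 [] :=
  ⟨0, rfl, rfl, fun a i => by simp [levelSum]⟩

theorem invPrec_pos (P : ParamTuple) : 0 < invPrec P := Nat.succ_pos _

theorem CostInv.cons {P : ParamTuple} {c : Point → Point} {T : Multiset Point} {L : List Cell}
    (h : CostInv P c T L) (a : ℕ) (y : Point) : CostInv P c (y ::ₘ T) ((a, 0, y) :: L) := by
  obtain ⟨G, rfl, hG, h⟩ := h
  refine ⟨(y, a, 0, y) ::ₘ G, by simp, by simp [hG], fun b j => ?_⟩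
  have := h b j
  simp only [levelSum, Multiset.map_cons, Multiset.sum_cons] at this ⊢
  split_ifs with hb
  · simp only [pathCost, centerCost, natDist_self, zero_add] at this ⊢
    nlinarith
  · simpa using this

theorem levelSum_snd (ψ : Point → ℕ) (a i : ℕ) {G : Multiset (Point × Cell)} {L : List Cell}
    (hG : G.map Prod.snd = (L : Multiset Cell)) :
    levelSum (fun g => ψ g.2.2.2) a i G = ((pointsAt a i L).map ψ).sum := by
  have h1 : levelSum (fun g => ψ g.2.2.2) a i G =
      ((G.map Prod.snd).map fun z => if z.1 = a ∧ z.2.1 = i then ψ z.2.2 else 0).sum := by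
    rw [levelSum, Multiset.map_map]
    rfl
  rw [h1, hG, Multiset.map_coe, Multiset.sum_coe, pointsAt]
  clear h1 hG
  induction L with
  | nil => rfl
  | cons z L ih =>
    by_cases hz : z.1 = a ∧ z.2.1 = i <;> simp [hz, ih]

theorem levelSum_add (φ ψ : Point × Cell → ℕ) (a i : ℕ) (G : Multiset (Point × Cell)) :
    levelSum (fun g => φ g + ψ g) a i G = levelSum φ a i G + levelSum ψ a i G := by
  rw [levelSum, levelSum, levelSum, ← Multiset.sum_map_add]
  congr 1
  refine Multiset.map_congr rfl fun g _ => ?_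
  split_ifs <;> rfl

theorem levelSum_mono {φ ψ : Point × Cell → ℕ} (h : ∀ g, φ g ≤ ψ g) (a i : ℕ)
    (G : Multiset (Point × Cell)) : levelSum φ a i G ≤ levelSum ψ a i G :=
  Multiset.sum_map_le_sum_map _ _ fun g _ => by
    split_ifs
    · exact h g
    · exact le_refl _

theorem nearest_le {R : List Point} {r : Point} (hr : r ∈ R) (z : Point) :
    natDist z (nearest R z) ≤ natDist z r :=
  argminOn_le (natDist z) (List.mem_cons_of_mem _ hr)

/-- The search beats the representatives of `exists_snap` with `L = 2 ^ a` and `E = 2 * e * 2 ^ a`.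
Their number is at most `289 * k * 2 ^ a * E ^ 2 = 1156 * k * e ^ 2 * 8 ^ a`; the constant 1157 in
`capacity` makes this strict. -/
theorem snapCost_bestReps_le {P : ParamTuple} {K : Finset Point} {c : Point → Point}
    (hc : ∀ y, c y ∈ K) (hK : K.card ≤ P.1) {Y : List Point} {a : ℕ}
    (hY : Y.length < 2 ^ 2 ^ a) :
    2 * invPrec P * 2 ^ a * snapCost Y (bestReps (capacity P a) Y) ≤
      (Y.map fun y => natDist y (c y)).sum := by
  have he := invPrec_pos P
  have hK0 : 0 < K.card := Finset.card_pos.2 ⟨_, hc (0, 0)⟩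
  obtain ⟨f, hf, hcard, hcost⟩ := exists_snap K c hc (Y : Multiset Point) (L := 2 ^ a)
    (E := 2 * invPrec P * 2 ^ a) (by positivity) (by simpa using hY)
  set R := Y.dedup.filter fun y => y ∈ Y.toFinset.image f with hR
  have hRY : R.Sublist Y := List.filter_sublist.trans (List.dedup_sublist _)
  have hlen : R.length < capacity P a := by
    have h1 : R.length = R.toFinset.card :=
      (List.toFinset_card_of_nodup ((List.nodup_dedup _).filter _)).symm
    have h2 : R.toFinset.card ≤ (Y.toFinset.image f).card := Finset.card_le_card fun y hy => by
      rw [List.mem_toFinset, hR, List.mem_filter] at hy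
      simpa using hy.2
    have h3 : (8 : ℕ) ^ a = 2 ^ a * (2 ^ a) ^ 2 := by
      rw [show (8 : ℕ) = 2 ^ 3 by norm_num, ← pow_mul, ← pow_mul, ← pow_add]; congr 1; ring
    calc R.length ≤ 289 * K.card * 2 ^ a * (2 * invPrec P * 2 ^ a) ^ 2 := by
          rw [h1]; exact h2.trans hcard
      _ = 1156 * K.card * invPrec P ^ 2 * 8 ^ a := by rw [h3]; ring
      _ < 1157 * K.card * invPrec P ^ 2 * 8 ^ a := by
          have : 0 < K.card * invPrec P ^ 2 * 8 ^ a := by positivity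
          linarith
      _ ≤ capacity P a := by unfold capacity; gcongr
  have hbest : snapCost Y (bestReps (capacity P a) Y) ≤ snapCost Y R :=
    argminOn_le _ (List.mem_cons_of_mem _ (by simp [hRY, hlen]))
  have hsnap : snapCost Y R ≤ ((Y : Multiset Point).map fun y => natDist y (f y)).sum := by
    rw [Multiset.map_coe, Multiset.sum_coe]
    refine List.sum_le_sum fun y hy => nearest_le ?_ y
    rw [hR, List.mem_filter]
    refine ⟨List.mem_dedup.2 (by simpa using hf y (by simpa using hy)), ?_⟩
    simp only [decide_eq_true_eq]
    exact Finset.mem_image_of_mem _ (List.mem_toFinset.2 hy)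
  exact (Nat.mul_le_mul_left _ (hbest.trans hsnap)).trans hcost

theorem length_pointsAt_le (a i : ℕ) (L : List Cell) :
    (pointsAt a i L).length ≤ epochCount a L := by
  rw [pointsAt, List.length_map, ← List.countP_eq_length_filter]
  exact List.countP_mono_left fun z _ h => by simp only [decide_eq_true_eq] at h ⊢; exact h.1

/-- The path from a stored point back to its original and on to the center bounds the distance of
the stored point to `K`. So snapping level `i` costs at most `1 / (2 * e * 2 ^ a)` times the path
cost of that level, which is at most twice its center cost. The factor `1 + i / (e * 2 ^ a)`
therefore grows linearly in `i`. -/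
theorem CostInv.compress {P : ParamTuple} {K : Finset Point} {c : Point → Point}
    (hc : ∀ y, c y ∈ K) (hcK : ∀ y, ∀ x ∈ K, natDist y (c y) ≤ natDist y x) (hK : K.card ≤ P.1)
    {Δ : ℕ} {T : Multiset Point} {L : List Cell} (hL : StateInv Δ L) (h : CostInv P c T L)
    (a i : ℕ) : CostInv P c T (compress P a L i) := by
  unfold EMDStream.compress
  split_ifs with hd
  swap
  · exact h
  obtain ⟨G, rfl, hG, h⟩ := h
  have hi : i < 2 ^ a := by
    obtain ⟨y, hy⟩ := List.exists_mem_of_length_pos ((Nat.zero_le _).trans_lt hd)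
    exact hL.level_lt (mem_pointsAt.1 (List.mem_dedup.1 hy))
  have hsnap := snapCost_bestReps_le hc hK
    ((length_pointsAt_le a i L).trans_lt (hL.epochCount_lt a))
  set R := bestReps (capacity P a) (pointsAt a i L)
  set step : Point × Cell → Point × Cell := fun g => (g.1, snapCell a i R g.2) with hstep
  refine ⟨G.map step, ?_, ?_, fun b j => ?_⟩
  · rw [Multiset.map_map]; rfl
  · rw [← Multiset.map_coe, ← hG, Multiset.map_map, Multiset.map_map]; rfl
  have hmap : ∀ φ, levelSum φ b j (G.map step) =
      (G.map fun g => if (step g).2.1 = b ∧ (step g).2.2.1 = j then φ (step g) else 0).sum := by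
    intro φ; rw [levelSum, Multiset.map_map]; rfl
  have hpos : ∀ g : Point × Cell, g.2.1 = a ∧ g.2.2.1 = i →
      step g = (g.1, a, i + 1, nearest R g.2.2.2) := fun g hg => by
    simp only [hstep, snapCell, if_pos hg]
  have hneg : ∀ g : Point × Cell, ¬ (g.2.1 = a ∧ g.2.2.1 = i) → step g = g := fun g hg => by
    simp only [hstep, snapCell, if_neg hg]
  by_cases hbj : b = a ∧ j = i + 1
  · obtain ⟨rfl, rfl⟩ := hbj
    have hsum : ∀ φ : Point × Cell → ℕ, levelSum φ b (i + 1) (G.map step) =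
        levelSum (fun g => φ (g.1, b, i + 1, nearest R g.2.2.2)) b i G +
          levelSum φ b (i + 1) G := by
      intro φ
      rw [hmap, levelSum, levelSum, ← Multiset.sum_map_add]
      congr 1
      refine Multiset.map_congr rfl fun g _ => ?_
      by_cases hg : g.2.1 = b ∧ g.2.2.1 = i
      · have : ¬ (g.2.1 = b ∧ g.2.2.1 = i + 1) := by omega
        rw [hpos g hg, if_pos ⟨rfl, rfl⟩, if_pos hg, if_neg this, add_zero]
      · rw [hneg g hg, if_neg hg, zero_add]
    rw [hsum, hsum]
    have h1 : levelSum (fun g => pathCost c (g.1, b, i + 1, nearest R g.2.2.2)) b i G ≤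
        levelSum (pathCost c) b i G + snapCost (pointsAt b i L) R := by
      rw [snapCost, ← levelSum_snd (fun y => natDist y (nearest R y)) b i hG, ← levelSum_add]
      refine levelSum_mono (fun g => ?_) b i G
      have := natDist_triangle g.1 g.2.2.2 (nearest R g.2.2.2)
      simp only [pathCost]
      omega
    have h2 : levelSum (fun g => centerCost c (g.1, b, i + 1, nearest R g.2.2.2)) b i G =
        levelSum (centerCost c) b i G := rfl
    have h3 : ((pointsAt b i L).map fun y => natDist y (c y)).sum ≤
        levelSum (pathCost c) b i G := by
      rw [← levelSum_snd (fun y => natDist y (c y)) b i hG]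
      refine levelSum_mono (fun g => ?_) b i G
      have h4 := hcK g.2.2.2 _ (hc g.1)
      have h5 := natDist_triangle g.2.2.2 g.1 (c g.1)
      rw [natDist_comm g.2.2.2 g.1] at h5
      simp only [pathCost]
      omega
    rw [h2]
    have h6 := h b i
    have h7 := h b (i + 1)
    have h8 := hsnap.trans h3
    have he := invPrec_pos P
    set eB := invPrec P * 2 ^ b with heB
    have heB0 : 0 < eB := by positivity
    have hiB : i ≤ eB := hi.le.trans (Nat.le_mul_of_pos_left _ he)
    set A := levelSum (pathCost c) b i G
    set D := levelSum (centerCost c) b i G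
    -- Levels stay below `2 ^ a`, so the accumulated factor is at most 2.
    have h9 : A ≤ 2 * D := by
      refine Nat.le_of_mul_le_mul_left (h6.trans ?_) heB0
      calc (eB + i) * D ≤ (eB + eB) * D := by gcongr
        _ = _ := by ring
    have h10 : eB * snapCost (pointsAt b i L) R ≤ D := by
      have : 2 * invPrec P * 2 ^ b = 2 * eB := by rw [heB]; ring
      rw [this] at h8
      have h11 := h8.trans h9
      rw [mul_assoc] at h11
      omega
    calc eB * (_ + _) ≤ eB * (A + snapCost (pointsAt b i L) R +
          levelSum (pathCost c) b (i + 1) G) := by gcongr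
      _ = eB * A + eB * snapCost (pointsAt b i L) R +
          eB * levelSum (pathCost c) b (i + 1) G := by ring
      _ ≤ (eB + i) * D + D + (eB + (i + 1)) * levelSum (centerCost c) b (i + 1) G := by gcongr
      _ = _ := by ring
  · by_cases hbi : b = a ∧ j = i
    · obtain ⟨rfl, rfl⟩ := hbi
      have hz : ∀ φ : Point × Cell → ℕ, levelSum φ b j (G.map step) = 0 := by
        intro φ
        rw [hmap]
        refine Multiset.sum_eq_zero fun x hx => ?_
        obtain ⟨g, _, rfl⟩ := Multiset.mem_map.1 hx
        refine if_neg ?_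
        by_cases hg : g.2.1 = b ∧ g.2.2.1 = j
        · rw [hpos g hg]; simp
        · rw [hneg g hg]; exact hg
      rw [hz, hz, mul_zero, mul_zero]
    · have hsame : ∀ φ : Point × Cell → ℕ, levelSum φ b j (G.map step) = levelSum φ b j G := by
        intro φ
        rw [hmap, levelSum]
        congr 1
        refine Multiset.map_congr rfl fun g _ => ?_
        by_cases hg : g.2.1 = a ∧ g.2.2.1 = i
        · rw [hpos g hg, if_neg (fun hh => hbj ⟨hh.1.symm, hh.2.symm⟩), if_neg]
          rintro ⟨h1, h2⟩
          exact hbi ⟨h1.symm.trans hg.1, h2.symm.trans hg.2⟩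
        · rw [hneg g hg]
      rw [hsame, hsame]
      exact h b j

theorem CostInv.insertPoint {P : ParamTuple} {K : Finset Point} {c : Point → Point}
    (hc : ∀ y, c y ∈ K) (hcK : ∀ y, ∀ x ∈ K, natDist y (c y) ≤ natDist y x) (hK : K.card ≤ P.1)
    {Δ : ℕ} {T : Multiset Point} {L : List Cell} (hL : StateInv Δ L) (h : CostInv P c T L)
    (hP : ∀ a, 0 < capacity P a) {y : Point} (hy : y.1 ≤ Δ ∧ y.2 ≤ Δ) :
    CostInv P c (y ::ₘ T) (insertPoint P L y) :=
  (insertPoint_induction (fun _ L' => StateInv Δ L' ∧ CostInv P c (y ::ₘ T) L')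
    ⟨hL.cons hy, h.cons _ y⟩ fun i _ h =>
      ⟨h.1.compress (hP _), h.2.compress hc hcK hK h.1 _ i⟩).2

theorem sum_levelSum (φ : Point × Cell → ℕ) (Q : Finset (ℕ × ℕ)) (G : Multiset (Point × Cell))
    (hQ : ∀ g ∈ G, (g.2.1, g.2.2.1) ∈ Q) :
    ∑ q ∈ Q, levelSum φ q.1 q.2 G = (G.map φ).sum := by
  induction G using Multiset.induction with
  | empty => simp [levelSum]
  | cons g G ih =>
    simp only [levelSum, Multiset.map_cons, Multiset.sum_cons, Finset.sum_add_distrib] at ih ⊢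
    rw [ih fun g hg => hQ g (Multiset.mem_cons_of_mem hg)]
    congr 1
    rw [Finset.sum_eq_single (g.2.1, g.2.2.1)]
    · rw [if_pos ⟨rfl, rfl⟩]
    · rintro q _ hq
      exact if_neg fun h => hq (by rw [h.1, h.2])
    · exact fun h => (h (hQ g (Multiset.mem_cons_self _ _))).elim

/-- The stored points are coupled with the inserted points at small cost. -/
theorem CostInv.exists_coupling {P : ParamTuple} {c : Point → Point} {Δ : ℕ} {T : Multiset Point}
    {L : List Cell} (hL : StateInv Δ L) (h : CostInv P c T L) :
    ∃ C : Multiset (Point × Point), C.map Prod.fst = T ∧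
      C.map Prod.snd = ((L.map fun z => z.2.2 : List Point) : Multiset Point) ∧
      invPrec P * couplingCost C ≤ (T.map fun x => natDist x (c x)).sum := by
  obtain ⟨G, rfl, hG, h⟩ := h
  refine ⟨G.map fun g => (g.1, g.2.2.2), ?_, ?_, ?_⟩
  · rw [Multiset.map_map]; rfl
  · rw [← Multiset.map_coe, ← hG, Multiset.map_map, Multiset.map_map]; rfl
  set Q := (G.map fun g => (g.2.1, g.2.2.1)).toFinset with hQ
  have hQG : ∀ g ∈ G, (g.2.1, g.2.2.1) ∈ Q := fun g hg =>
    Multiset.mem_toFinset.2 (Multiset.mem_map.2 ⟨g, hg, rfl⟩)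
  rw [couplingCost, Multiset.map_map, Multiset.map_map]
  change invPrec P * (G.map fun g => natDist g.1 g.2.2.2).sum ≤ (G.map (centerCost c)).sum
  rw [← sum_levelSum _ Q G hQG, ← sum_levelSum _ Q G hQG, Finset.mul_sum]
  refine Finset.sum_le_sum fun q hq => ?_
  have hlt : q.2 < 2 ^ q.1 := by
    obtain ⟨g, hg, rfl⟩ := Multiset.mem_map.1 (Multiset.mem_toFinset.1 hq)
    refine hL.level_lt (z := g.2) ?_
    rw [← Multiset.mem_coe, ← hG]
    exact Multiset.mem_map_of_mem _ hg
  have hs : levelSum (pathCost c) q.1 q.2 G =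
      levelSum (fun g => natDist g.1 g.2.2.2) q.1 q.2 G + levelSum (centerCost c) q.1 q.2 G :=
    levelSum_add _ _ _ _ _
  have := h q.1 q.2
  -- Cancelling the center cost leaves `e * 2 ^ a` times the moving cost, bounded by `i < 2 ^ a`
  -- times the center cost.
  rw [hs, mul_add, add_mul, add_comm, Nat.add_le_add_iff_left] at this
  refine Nat.le_of_mul_le_mul_left (c := 2 ^ q.1) ?_ (by positivity)
  calc 2 ^ q.1 * (invPrec P * levelSum (fun g => natDist g.1 g.2.2.2) q.1 q.2 G)
      = invPrec P * 2 ^ q.1 * levelSum (fun g => natDist g.1 g.2.2.2) q.1 q.2 G := by ring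
    _ ≤ _ := this.trans (Nat.mul_le_mul_right _ hlt.le)

/-! ### The memory of the algorithm -/

/-- The memory keeps multiplicities but not the order, which is why every invariant comes with a
`perm` lemma. -/
theorem expand_compact (L : List (ℕ × Cell)) : (expand (compact L)).Perm L := by
  have h : expand (compact L) = L.dedup.flatMap fun z => List.replicate (L.count z) z := by
    simp only [expand, compact, List.flatMap_map, Denumerable.ofNat_encode]
  rw [h, List.perm_iff_count]
  intro a
  rw [List.count_flatMap]
  by_cases ha : a ∈ L
  · rw [← List.sum_toFinset _ (List.nodup_dedup L), Finset.sum_eq_single a]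
    · simp
    · intro b _ hb
      simp [List.count_replicate, hb]
    · intro h; simp [ha] at h
  · rw [List.count_eq_zero_of_not_mem ha]
    refine List.sum_eq_zero fun x hx => ?_
    obtain ⟨z, hz, rfl⟩ := List.mem_map.1 hx
    rw [Function.comp_apply, List.count_replicate, if_neg]
    intro hza
    exact ha (by rw [← eq_of_beq hza]; exact List.mem_dedup.1 hz)

/-- The memory stores one word for every distinct labelled cell. -/
structure IsCompact (M : List ℕ) : Prop where
  length_eq : M.length = (expand M).toFinset.card
  word_eq : ∀ w ∈ M, ∃ z ∈ expand M, w = Encodable.encode ((expand M).count z, z)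

theorem isCompact_compact (L : List (ℕ × Cell)) : IsCompact (compact L) where
  length_eq := by
    rw [List.toFinset_eq_of_perm _ _ (expand_compact L), List.card_toFinset, compact,
      List.length_map]
  word_eq w hw := by
    obtain ⟨z, hz, rfl⟩ := List.mem_map.1 hw
    exact ⟨z, (expand_compact L).mem_iff.2 (List.mem_dedup.1 hz), by
      rw [(expand_compact L).count_eq]⟩

theorem labelled_perm {L L' : List (ℕ × Cell)} (h : L.Perm L') (b : ℕ) :
    (labelled b L).Perm (labelled b L') := (h.filter _).map _

theorem labelled_replace (b b' : ℕ) (L : List (ℕ × Cell)) (N : List Cell) :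
    labelled b' ((L.filter fun z => ¬ z.1 = b) ++ N.map fun z => (b, z)) =
      if b' = b then N else labelled b' L := by
  rw [labelled, List.filter_append, List.map_append, List.filter_filter, List.filter_map,
    List.map_map]
  split_ifs with h
  · subst h
    have h1 : (L.filter fun z => (decide (z.1 = b') && decide ¬ z.1 = b')) = [] :=
      List.filter_eq_nil_iff.2 fun z _ => by simp
    have h2 : (N.filter ((fun z : ℕ × Cell => decide (z.1 = b')) ∘ fun z => (b', z))) = N :=
      List.filter_eq_self.2 fun z _ => by simp
    rw [h1, h2]
    simp [Function.comp_def]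
  · have h1 : (L.filter fun z => (decide (z.1 = b') && decide ¬ z.1 = b)) =
        L.filter fun z => z.1 = b' :=
      List.filter_congr fun z _ => by by_cases hz : z.1 = b' <;> simp [hz, h]
    have h2 : (N.filter ((fun z : ℕ × Cell => decide (z.1 = b')) ∘ fun z => (b, z))) = [] :=
      List.filter_eq_nil_iff.2 fun z _ => by simp [Ne.symm h]
    rw [h1, h2, labelled]
    simp

theorem mem_labelled {b : ℕ} {L : List (ℕ × Cell)} {z : Cell} :
    z ∈ labelled b L ↔ (b, z) ∈ L := by
  simp [labelled]

/-- What holds for the memory after the points of the stream `l` have arrived. -/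
structure MemoryInv (P : ParamTuple) (Δ : ℕ) (M : List ℕ) (l : List Item) : Prop where
  compact : IsCompact M
  label_le : ∀ z ∈ expand M, z.1 ≤ 1
  length_eq : ∀ b : Bool, (labelled b.toNat (expand M)).length = (inserted b l).card
  state : ∀ b : Bool, StateInv Δ (labelled b.toNat (expand M))
  bounded : ∀ b : Bool, Bounded P (labelled b.toNat (expand M))
  -- All center sets are covered at once, since the right one is known only when the stream has
  -- ended.
  cost : ∀ (K : Finset Point) (c : Point → Point), (∀ y, c y ∈ K) →
    (∀ y, ∀ x ∈ K, natDist y (c y) ≤ natDist y x) → K.card ≤ P.1 →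
    ∀ b : Bool, CostInv P c (inserted b l) (labelled b.toNat (expand M))

theorem inserted_append_singleton (b : Bool) (l : List Item) (x : Item) :
    inserted b (l ++ [x]) = if b = x.1 then x.2 ::ₘ inserted b l else inserted b l := by
  have h : (l ++ [x]).Perm (x :: l) := List.perm_append_singleton x l
  rw [inserted, Multiset.coe_eq_coe.2 ((h.filter _).map _), List.filter_cons]
  by_cases hb : b = x.1
  · simp [hb, inserted]
  · simp [hb, Ne.symm hb, inserted]

theorem MemoryInv.nil (P : ParamTuple) (Δ : ℕ) : MemoryInv P Δ [] [] where
  compact := ⟨rfl, by simp⟩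
  label_le := by simp [expand]
  length_eq _ := rfl
  state _ := StateInv.nil Δ
  bounded _ _ _ := Nat.zero_le _
  cost _ c _ _ _ _ := CostInv.nil P c

theorem MemoryInv.nextMemory {P : ParamTuple} {Δ : ℕ} {M : List ℕ} {l : List Item}
    (h : MemoryInv P Δ M l) (hP : ∀ a, 0 < capacity P a) (hpq : ¬ P.2.2.2 ≤ P.2.2.1) {x : Item}
    (hx : x.2.1 ≤ Δ ∧ x.2.2 ≤ Δ) : MemoryInv P Δ (nextMemory P M x) (l ++ [x]) := by
  rw [EMDStream.nextMemory, if_neg hpq]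
  set N := insertPoint P (labelled x.1.toNat (expand M)) x.2 with hN
  set W := ((expand M).filter fun z => ¬ z.1 = x.1.toNat) ++ N.map fun z => (x.1.toNat, z) with hW
  have hE : (expand (EMDStream.compact W)).Perm W := expand_compact W
  have hlab : ∀ b : Bool, (if b = x.1 then N else labelled b.toNat (expand M)).Perm
      (labelled b.toNat (expand (EMDStream.compact W))) := fun b => by
    have := labelled_replace x.1.toNat b.toNat (expand M) N
    refine List.Perm.trans (List.Perm.of_eq ?_) (labelled_perm hE b.toNat).symm
    rw [hW, this]
    cases b <;> cases x.1 <;> rfl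
  refine ⟨isCompact_compact W, fun z hz => ?_, fun b => ?_, fun b => ?_, fun b => ?_,
    fun K c hc hcK hK b => ?_⟩
  · rcases List.mem_append.1 (hE.mem_iff.1 hz) with hz | hz
    · exact h.label_le z (List.mem_filter.1 hz).1
    · obtain ⟨w, _, rfl⟩ := List.mem_map.1 hz
      exact Bool.toNat_le x.1
  · rw [← (hlab b).length_eq, inserted_append_singleton]
    split_ifs with hb
    · rw [hN, length_insertPoint, Multiset.card_cons, hb, h.length_eq]
    · exact h.length_eq b
  · refine StateInv.perm ?_ (hlab b)
    split_ifs
    · exact (h.state x.1).insertPoint hP hx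
    · exact h.state b
  · refine Bounded.perm ?_ (hlab b)
    split_ifs
    · exact Bounded.insertPoint (h.state x.1) (h.bounded x.1) hP hx
    · exact h.bounded b
  · refine CostInv.perm ?_ (hlab b)
    rw [inserted_append_singleton]
    split_ifs with hb
    · rw [hb]
      exact (h.cost K c hc hcK hK x.1).insertPoint hc hcK hK (h.state x.1) hP hx
    · exact h.cost K c hc hcK hK b

theorem memoryInv_memory {P : Params} (hk : 0 < P.k) (hpq : ¬ P.q ≤ P.p) (l : List Item)
    (hl : ∀ x ∈ l, x.2.1 ≤ P.Δ ∧ x.2.2 ≤ P.Δ) :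
    MemoryInv P.tuple P.Δ (algorithm.memory P l) l := by
  have hP : ∀ a, 0 < capacity P.tuple a := fun a => by
    have := invPrec_pos P.tuple
    have : 0 < P.tuple.1 := hk
    unfold capacity
    positivity
  induction l using List.reverseRecOn with
  | nil => exact MemoryInv.nil _ _
  | append_singleton l x ih =>
    rw [StreamingAlgorithm.memory, List.foldl_append]
    exact (ih fun y hy => hl y (by simp [hy])).nextMemory hP hpq (hl x (by simp))

theorem memory_eq_nil {P : Params} (hpq : P.q ≤ P.p) (l : List Item) :
    algorithm.memory P l = [] := by
  induction l using List.reverseRecOn with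
  | nil => rfl
  | append_singleton l x ih =>
    rw [StreamingAlgorithm.memory, List.foldl_append]
    exact if_pos hpq

theorem MemoryInv.length_le {P : ParamTuple} {Δ : ℕ} {M : List ℕ} {l : List Item}
    (h : MemoryInv P Δ M l) {n : ℕ} (hn : ∀ b, (inserted b l).card ≤ n) :
    M.length ≤ 9256 * P.1 * invPrec P ^ 2 * 16 ^ epoch n := by
  have hb : ∀ b : Bool, (labelled b.toNat (expand M)).toFinset.card ≤
      4628 * P.1 * invPrec P ^ 2 * 16 ^ epoch n := fun b => by
    refine ((h.state b).card_toFinset_le (h.bounded b)).trans ?_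
    rw [h.length_eq]
    exact Nat.mul_le_mul_left _ (Nat.pow_le_pow_right (by norm_num) (epoch_mono (hn b)))
  have hsub : (expand M).toFinset ⊆
      ((labelled 0 (expand M)).toFinset.image fun z => (0, z)) ∪
        ((labelled 1 (expand M)).toFinset.image fun z => (1, z)) := by
    rintro ⟨b, z⟩ hz
    rw [List.mem_toFinset] at hz
    have hb := h.label_le _ hz
    simp only [Finset.mem_union, Finset.mem_image, List.mem_toFinset, mem_labelled, Prod.mk.injEq]
    rcases Nat.le_one_iff_eq_zero_or_eq_one.1 hb with hb | hb
    · exact Or.inl ⟨z, by rw [← hb]; exact hz, hb.symm, rfl⟩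
    · exact Or.inr ⟨z, by rw [← hb]; exact hz, hb.symm, rfl⟩
  rw [h.compact.length_eq]
  calc (expand M).toFinset.card ≤ _ := (Finset.card_le_card hsub).trans (Finset.card_union_le _ _)
    _ ≤ _ := Nat.add_le_add (Finset.card_image_le.trans (hb false))
          (Finset.card_image_le.trans (hb true))
    _ = _ := by ring

/-! ### Size of the words -/

theorem pair_le_pow {X c a b : ℕ} (hX : 2 ≤ X) (hc : 1 ≤ c) (ha : a ≤ X ^ c) (hb : b ≤ X ^ c) :
    Nat.pair a b ≤ X ^ (4 * c) := by
  have h1 : 2 ≤ X ^ c := hX.trans (Nat.le_self_pow (by omega) X)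
  have h2 : max a b + 1 ≤ (X ^ c) ^ 2 := by
    have : max a b ≤ X ^ c := max_le ha hb
    nlinarith
  calc Nat.pair a b ≤ (max a b + 1) ^ 2 := (Nat.pair_lt_max_add_one_sq a b).le
    _ ≤ ((X ^ c) ^ 2) ^ 2 := Nat.pow_le_pow_left h2 2
    _ = X ^ (4 * c) := by rw [← pow_mul, ← pow_mul]; congr 1; ring

/-- Five nested pairings each multiply the exponent by 4, and `1024 = 4 ^ 5`. -/
theorem encode_le_pow {X m : ℕ} {z : ℕ × Cell} (hX : 2 ≤ X) (hm : m ≤ X) (h1 : z.1 ≤ X)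
    (h2 : z.2.1 ≤ X) (h3 : z.2.2.1 ≤ X) (h4 : z.2.2.2.1 ≤ X) (h5 : z.2.2.2.2 ≤ X) :
    Encodable.encode (m, z) ≤ X ^ 1024 := by
  obtain ⟨b, a, i, x, y⟩ := z
  have hle : ∀ c, c ≠ 0 → ∀ w, w ≤ X → w ≤ X ^ c := fun c hc w hw =>
    hw.trans (Nat.le_self_pow hc X)
  rw [show 1024 = 4 * 256 from rfl]
  exact pair_le_pow (c := 256) hX (by norm_num) (hle _ (by norm_num) _ hm) <|
    pair_le_pow (c := 64) hX (by norm_num) (hle _ (by norm_num) _ h1) <|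
    pair_le_pow (c := 16) hX (by norm_num) (hle _ (by norm_num) _ h2) <|
    pair_le_pow (c := 4) hX (by norm_num) (hle _ (by norm_num) _ h3) <|
    pair_le_pow (c := 1) hX (by norm_num) (hle _ (by norm_num) _ h4) (hle _ (by norm_num) _ h5)

theorem MemoryInv.word_le {P : ParamTuple} {Δ : ℕ} {M : List ℕ} {l : List Item}
    (h : MemoryInv P Δ M l) {n : ℕ} (hn : ∀ b, (inserted b l).card ≤ n) (hn2 : 2 ≤ n)
    (hΔ : 0 < Δ) {w : ℕ} (hw : w ∈ M) : w ≤ (n * Δ) ^ 1024 := by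
  obtain ⟨z, hz, rfl⟩ := h.compact.word_eq w hw
  have hnX : n ≤ n * Δ := Nat.le_mul_of_pos_right _ hΔ
  have hΔX : Δ ≤ n * Δ := Nat.le_mul_of_pos_left _ (by omega)
  obtain ⟨b, hb⟩ : ∃ b : Bool, b.toNat = z.1 := by
    rcases Nat.le_one_iff_eq_zero_or_eq_one.1 (h.label_le z hz) with hb | hb
    · exact ⟨false, hb.symm⟩
    · exact ⟨true, hb.symm⟩
  have hlen : (labelled z.1 (expand M)).length ≤ n := by rw [← hb, h.length_eq]; exact hn b
  have hstate : StateInv Δ (labelled z.1 (expand M)) := hb ▸ h.state b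
  have hzl : z.2 ∈ labelled z.1 (expand M) := mem_labelled.2 hz
  have hcount : (expand M).count z ≤ n := by
    refine le_trans ?_ hlen
    rw [labelled, List.length_map, ← List.countP_eq_length_filter, List.count_eq_countP]
    refine List.countP_mono_left fun w _ hw => ?_
    rw [eq_of_beq hw, decide_eq_true_eq]
  have hlevel : z.2.2.1 ≤ n :=
    (Nat.lt_two_pow_self.le.trans (hstate.two_pow_le hzl)).trans
      (List.countP_le_length.trans hlen)
  have hepoch : z.2.1 ≤ n := ((hstate.epoch_le _ hzl).trans (epoch_le_self _)).trans hlen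
  have hgrid := hstate.grid _ hzl
  exact encode_le_pow (hn2.trans hnX) (hcount.trans hnX)
    ((h.label_le z hz).trans (by omega)) (hepoch.trans hnX) (hlevel.trans hnX)
    (hgrid.1.trans hΔX) (hgrid.2.trans hΔX)

/-! ### The main theorem -/

/-- The last epoch `A` has begun, so `2 ^ 2 ^ (A - 1) ≤ n`. With `Real.log 2 ≥ 1 / 2` this gives `2
^ A ≤ 4 * Real.log n`. -/
theorem sixteen_pow_epoch_le {n : ℕ} (hn : 2 ≤ n) :
    (16 : ℝ) ^ epoch n ≤ 256 * Real.log n ^ 4 := by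
  have h0 : epoch n ≠ 0 := fun h => by
    have := lt_two_pow_epoch n
    rw [h] at this
    norm_num at this
    omega
  have h1 := two_pow_le_of_epoch_ne_zero h0
  obtain ⟨a, ha⟩ := Nat.exists_eq_succ_of_ne_zero h0
  rw [ha, Nat.succ_eq_add_one, Nat.add_sub_cancel] at h1
  have h2 : (2 : ℝ) ^ 2 ^ a ≤ n := by exact_mod_cast h1
  have h3 : (2 : ℝ) ^ a * Real.log 2 ≤ Real.log n := by
    have := Real.log_le_log (by positivity) h2
    rwa [Real.log_pow, Nat.cast_pow, Nat.cast_ofNat] at this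
  have h4 : (1 : ℝ) / 2 ≤ Real.log 2 := by linarith [Real.log_two_gt_d9]
  have h5 : (2 : ℝ) ^ (a + 1) ≤ 4 * Real.log n := by
    have : (0 : ℝ) < 2 ^ a := by positivity
    rw [pow_succ]
    nlinarith
  calc (16 : ℝ) ^ epoch n = (2 ^ (a + 1)) ^ 4 := by
        rw [ha, ← pow_mul, mul_comm, pow_mul]; norm_num
    _ ≤ (4 * Real.log n) ^ 4 := pow_le_pow_left₀ (by positivity) h5 4
    _ = _ := by ring

/-- Points of `S` are their own centers, and a point of `T` is no farther from its center than from
its partner in an optimal coupling. -/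
theorem centerCost_le_emd {S T : Multiset Point} (h : S.card = T.card) {c : Point → Point}
    (hc : ∀ y, ∀ x ∈ S, natDist y (c y) ≤ natDist y x) :
    (((S.map fun x => natDist x (c x)).sum + (T.map fun x => natDist x (c x)).sum : ℕ) : ℝ) ≤
      emd S T := by
  have h0 : (S.map fun x => natDist x (c x)).sum = 0 := Multiset.sum_eq_zero fun w hw => by
    obtain ⟨x, hx, rfl⟩ := Multiset.mem_map.1 hw
    have := hc x x hx
    rwa [natDist_self, Nat.le_zero] at this
  obtain ⟨C, hCS, rfl, hC⟩ := exists_coupling h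
  rw [h0, zero_add, hC, Nat.cast_le, couplingCost, Multiset.map_map]
  refine Multiset.sum_map_le_sum_map _ _ fun z hz => ?_
  rw [Function.comp_apply, natDist_comm z.1]
  exact hc z.2 z.1 (hCS ▸ Multiset.mem_map_of_mem _ hz)

theorem exists_nearest (K : Finset Point) (hK : K.Nonempty) :
    ∃ c : Point → Point, (∀ y, c y ∈ K) ∧ ∀ y, ∀ x ∈ K, natDist y (c y) ≤ natDist y x := by
  choose c hc using fun y => K.exists_min_image (natDist y) hK
  exact ⟨c, fun y => (hc y).1, fun y => (hc y).2⟩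

theorem exists_centers {S T : Multiset Point} {n k : ℕ} (hn : 0 < n) (hS : S.card = n)
    (hT : T.card = n) (h : S.toFinset.card ≤ k ∨ T.toFinset.card ≤ k) :
    ∃ (K : Finset Point) (c : Point → Point), (∀ y, c y ∈ K) ∧
      (∀ y, ∀ x ∈ K, natDist y (c y) ≤ natDist y x) ∧ K.card ≤ k ∧
      (((S.map fun x => natDist x (c x)).sum + (T.map fun x => natDist x (c x)).sum : ℕ) : ℝ) ≤
        emd S T := by
  have hne : ∀ U : Multiset Point, U.card = n → U.toFinset.Nonempty := fun U hU => by
    obtain ⟨x, hx⟩ := Multiset.card_pos_iff_exists_mem.1 (hU ▸ hn)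
    exact ⟨x, Multiset.mem_toFinset.2 hx⟩
  rcases h with h | h
  · obtain ⟨c, hc, hcK⟩ := exists_nearest _ (hne S hS)
    exact ⟨_, c, hc, hcK, h, centerCost_le_emd (hS.trans hT.symm) fun y x hx =>
      hcK y x (Multiset.mem_toFinset.2 hx)⟩
  · obtain ⟨c, hc, hcK⟩ := exists_nearest _ (hne T hT)
    refine ⟨_, c, hc, hcK, h, ?_⟩
    rw [add_comm]
    exact (centerCost_le_emd (hT.trans hS.symm) fun y x hx =>
      hcK y x (Multiset.mem_toFinset.2 hx)).trans (emd_comm_le (hS.trans hT.symm))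

theorem abs_emd_sub_emd_le {S T S' T' : Multiset Point} (h : S.card = T.card)
    (hS : S.card = S'.card) (hT : T.card = T'.card) :
    |emd S' T' - emd S T| ≤ emd S S' + emd T T' := by
  have h1 := emd_triangle (hS.symm.trans h) hT
  have h2 := emd_triangle hS.symm h
  have h3 := emd_triangle hS (hS.symm.trans (h.trans hT))
  have h4 := emd_triangle (h.trans hT) hT.symm
  have h5 := emd_comm_le hS
  have h6 := emd_comm_le hT
  rw [abs_le]
  constructor <;> linarith

theorem MemoryInv.abs_finalEstimate_sub_le {P : ParamTuple} {Δ : ℕ} {M : List ℕ} {l : List Item}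
    (h : MemoryInv P Δ M l) (hpq : ¬ P.2.2.2 ≤ P.2.2.1) {S T : Multiset Point} {n : ℕ}
    (hn : 0 < n) (hl : Reveals l S T) (hS : S.card = n) (hT : T.card = n)
    (hk : S.toFinset.card ≤ P.1 ∨ T.toFinset.card ≤ P.1) :
    invPrec P * |(finalEstimate P M : ℝ) - emd S T| ≤ emd S T := by
  obtain ⟨K, c, hc, hcK, hK, hD⟩ := exists_centers hn hS hT hk
  have hcS := h.cost K c hc hcK hK true
  have hcT := h.cost K c hc hcK hK false
  rw [hl.1] at hcS
  rw [hl.2] at hcT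
  obtain ⟨C, hCS, hCS', hCc⟩ := hcS.exists_coupling (h.state true)
  obtain ⟨C', hCT, hCT', hCc'⟩ := hcT.exists_coupling (h.state false)
  have hlS : (storedPoints 1 M).length = n := by
    rw [storedPoints, List.length_map, ← hS, ← hl.1]
    exact h.length_eq true
  have hlT : (storedPoints 0 M).length = n := by
    rw [storedPoints, List.length_map, ← hT, ← hl.2]
    exact h.length_eq false
  rw [finalEstimate, if_neg hpq, minCost_eq_emd (hlS.trans hlT.symm)]
  have h1 := emd_map_le C
  have h2 := emd_map_le C'
  rw [hCS, hCS'] at h1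
  rw [hCT, hCT'] at h2
  have h3 := abs_emd_sub_emd_le (S := S) (T := T) (S' := storedPoints 1 M)
    (T' := storedPoints 0 M) (hS.trans hT.symm) (by rw [hS, Multiset.coe_card, hlS])
    (by rw [hT, Multiset.coe_card, hlT])
  have h4 : (invPrec P * (couplingCost C + couplingCost C') : ℝ) ≤ emd S T := by
    refine le_trans ?_ hD
    exact_mod_cast (mul_add _ _ _).le.trans (Nat.add_le_add hCc hCc')
  refine le_trans ?_ h4
  exact mul_le_mul_of_nonneg_left (h3.trans (add_le_add h1 h2)) (Nat.cast_nonneg _)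

/-- Here `q ≤ p * e ≤ 2 * q`, the upper bound because `p < q`. As `ε` is within a factor 2 of `p /
q`, it follows that `1 ≤ ε * e ≤ 4`. -/
theorem invPrec_bounds {k Δ p q : ℕ} {ε : ℝ} (hε : 0 < ε) (hp : 0 < p) (hpq : p < q)
    (h1 : (p : ℝ) / q ≤ ε) (h2 : ε ≤ 2 * ((p : ℝ) / q)) :
    1 ≤ ε * invPrec (k, Δ, p, q) ∧ (invPrec (k, Δ, p, q) : ℝ) ^ 2 ≤ 16 * (ε ^ 2)⁻¹ := by
  have hp' : (0 : ℝ) < p := Nat.cast_pos.2 hp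
  have hq' : (0 : ℝ) < q := Nat.cast_pos.2 (hp.trans hpq)
  have hlt : (q : ℝ) ≤ p * invPrec (k, Δ, p, q) := by
    have : q ≤ p * (q / p + 1) := (Nat.lt_mul_div_succ q hp).le
    exact_mod_cast this
  have hle : (p * invPrec (k, Δ, p, q) : ℝ) ≤ 2 * q := by
    have : p * (q / p + 1) ≤ 2 * q := by
      have := Nat.mul_div_le q p
      rw [mul_add, mul_one]
      omega
    exact_mod_cast this
  rw [div_le_iff₀ hq'] at h1
  rw [mul_div_assoc', le_div_iff₀ hq'] at h2
  have he : (0 : ℝ) ≤ invPrec (k, Δ, p, q) := Nat.cast_nonneg _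
  generalize (invPrec (k, Δ, p, q) : ℝ) = e at *
  have h3 : 1 ≤ ε * e := by
    by_contra! h
    nlinarith
  refine ⟨h3, ?_⟩
  have h4 : ε * e ≤ 4 := by
    by_contra! h
    nlinarith
  rw [← div_eq_mul_inv, le_div_iff₀ (by positivity)]
  nlinarith

theorem inserted_le_of_prefix {l' l : List Item} (h : l' <+: l) (b : Bool) :
    (inserted b l').card ≤ (inserted b l).card := by
  simp only [inserted, Multiset.coe_card, List.length_map]
  exact (h.sublist.filter _).length_le

theorem Reveals.card_inserted {l : List Item} {S T : Multiset Point} (h : Reveals l S T) {n : ℕ}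
    (hS : S.card = n) (hT : T.card = n) (b : Bool) : (inserted b l).card = n := by
  cases b
  · rw [h.2, hT]
  · rw [h.1, hS]

theorem Reveals.inGrid {l : List Item} {S T : Multiset Point} (h : Reveals l S T) {Δ : ℕ}
    (hS : ∀ x ∈ S, InGrid Δ x) (hT : ∀ x ∈ T, InGrid Δ x) : ∀ x ∈ l, InGrid Δ x.2 := by
  rintro ⟨b, y⟩ hx
  have hy : y ∈ inserted b l := by
    simp only [inserted, Multiset.mem_coe, List.mem_map, List.mem_filter]
    exact ⟨(b, y), ⟨hx, by simp⟩, rfl⟩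
  cases b
  · exact hT y (h.2 ▸ hy)
  · exact hS y (h.1 ▸ hy)

end EMDStream

/-- There are a streaming algorithm and absolute constants `C` and `c` such that for every `ε > 0`
(handed to the algorithm as a positive fraction `p / q` with `p / q ≤ ε ≤ 2 (p / q)`, for instance
as `ε` itself when `ε` is rational) the algorithm approximates the earth-mover distance within a
factor `1 ± ε` and stores `C k ε⁻² log⁴ n` words of `O(log (n Δ))` bits. -/
theorem mainTheorem1 :
    ∃ (A : EMDStream.StreamingAlgorithm) (C : ℝ) (c : ℕ),
      ∀ (ε : ℝ), 0 < ε →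
      ∀ (k Δ p q : ℕ), 0 < p → 0 < q → (p : ℝ) / (q : ℝ) ≤ ε → ε ≤ 2 * ((p : ℝ) / (q : ℝ)) →
      ∀ (n : ℕ), 2 ≤ n →
      ∀ (S T : Multiset EMDStream.Point),
        (∀ x ∈ S, EMDStream.InGrid Δ x) → (∀ x ∈ T, EMDStream.InGrid Δ x) →
        S.card = n → T.card = n →
        (S.toFinset.card ≤ k ∨ T.toFinset.card ≤ k) →
      ∀ (l : List EMDStream.Item), EMDStream.Reveals l S T →
        ((1 - ε) * EMDStream.emd S T ≤ (A.estimate ⟨k, Δ, p, q⟩ l : ℝ) ∧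
          (A.estimate ⟨k, Δ, p, q⟩ l : ℝ) ≤ (1 + ε) * EMDStream.emd S T) ∧
        A.UsesSpace ⟨k, Δ, p, q⟩ l (C * (k : ℝ) * (ε ^ 2)⁻¹ * (Real.log (n : ℝ)) ^ 4)
          ((n * Δ) ^ c) := by
  -- The factors come from the cell count for both labels, from `e ^ 2 ≤ 16 / ε ^ 2`, and from `16 ^
  -- epoch n ≤ 256 * log⁴ n`.
  refine ⟨EMDStream.algorithm, 9256 * 16 * 256, 1024, ?_⟩
  intro ε hε k Δ p q hp hq h1 h2 n hn S T hSΔ hTΔ hS hT hk l hl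
  have hemd := EMDStream.emd_nonneg S T
  -- If `q ≤ p` then `ε ≥ 1`, so the estimate 0 is good enough. Nothing may be stored in general,
  -- since the space bound tends to 0 as `ε` grows.
  rcases le_or_gt q p with hpq | hpq
  · have hmem : ∀ l, EMDStream.algorithm.memory ⟨k, Δ, p, q⟩ l = [] :=
      EMDStream.memory_eq_nil hpq
    have hest : EMDStream.algorithm.estimate ⟨k, Δ, p, q⟩ l = 0 := if_pos hpq
    have hε1 : 1 ≤ ε := le_trans ((one_le_div (Nat.cast_pos.2 hq)).2 (Nat.cast_le.2 hpq)) h1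
    refine ⟨?_, fun l' _ => ?_⟩
    · rw [hest, Nat.cast_zero]
      exact ⟨mul_nonpos_of_nonpos_of_nonneg (by linarith) hemd, by positivity⟩
    · rw [hmem]
      exact ⟨by rw [List.length_nil, Nat.cast_zero]; positivity, by simp⟩
  · have hk0 : 0 < k := by
      obtain ⟨K, c, hc, -, hK, -⟩ := EMDStream.exists_centers (by omega) hS hT hk
      exact (Finset.card_pos.2 ⟨_, hc (0, 0)⟩).trans_le hK
    have hgrid := hl.inGrid hSΔ hTΔ
    have hΔ : 0 < Δ := by
      obtain ⟨x, hx⟩ := Multiset.card_pos_iff_exists_mem.1 (by omega : 0 < S.card)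
      have := hSΔ x hx
      exact Nat.lt_of_lt_of_le Nat.zero_lt_one (this.1.1.trans this.1.2)
    have hinv : ∀ l', l' <+: l → EMDStream.MemoryInv (k, Δ, p, q) Δ
        (EMDStream.algorithm.memory ⟨k, Δ, p, q⟩ l') l' := fun l' hl' =>
      EMDStream.memoryInv_memory (P := ⟨k, Δ, p, q⟩) hk0 (not_le.2 hpq) l' fun x hx =>
        ⟨(hgrid x (hl'.subset hx)).1.2, (hgrid x (hl'.subset hx)).2.2⟩
    obtain ⟨he, he2⟩ := EMDStream.invPrec_bounds (k := k) (Δ := Δ) hε hp hpq h1 h2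
    refine ⟨?_, fun l' hl' => ?_⟩
    · have h := (hinv l (List.prefix_refl l)).abs_finalEstimate_sub_le (not_le.2 hpq)
        (by omega) hl hS hT hk
      have h3 : |(EMDStream.algorithm.estimate ⟨k, Δ, p, q⟩ l : ℝ) - EMDStream.emd S T| ≤
          ε * EMDStream.emd S T := by
        refine le_trans ?_ (mul_le_mul_of_nonneg_left h hε.le)
        rw [← mul_assoc]
        exact le_mul_of_one_le_left (abs_nonneg _) he
      rw [abs_le] at h3
      constructor <;> linarith
    · have hcard : ∀ b, (EMDStream.inserted b l').card ≤ n := fun b =>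
        (EMDStream.inserted_le_of_prefix hl' b).trans (hl.card_inserted hS hT b).le
      refine ⟨?_, fun w hw => (hinv l' hl').word_le hcard hn hΔ hw⟩
      have h3 : ((EMDStream.algorithm.memory ⟨k, Δ, p, q⟩ l').length : ℝ) ≤
          9256 * k * (EMDStream.invPrec (k, Δ, p, q) : ℝ) ^ 2 * 16 ^ EMDStream.epoch n := by
        exact_mod_cast (hinv l' hl').length_le hcard
      calc _ ≤ _ := h3
        _ ≤ 9256 * k * (16 * (ε ^ 2)⁻¹) * (256 * Real.log n ^ 4) := by
            gcongr
            exact EMDStream.sixteen_pow_epoch_le hn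
        _ = _ := by ring
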